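/- Let $t_{i}=i/n$, $i=1,\dots,n$, and let $Y(t)=f(t)+\sigma Z(t)$, $0\le t\le 1$, where $\sigma>0$, $Z$ is standard Gaussian white noise (the $Z(t)$ are independent standard normal random variables), and $f$ is differentiable on $[0,1]$ with $f^{(1)}(t)-f^{(1)}(0)=\int_0^t f^{(2)}(u)\,du$ for $0\le t\le 1$ and $\int_0^1 f^{(2)}(u)^2\,du<\infty$. Put $Y_n=(Y(t_1),\dots,Y(t_n))^t$. Let $\Omega_n=Q_nR_n^{-1}Q_n^t$ be the roughness matrix of natural cubic splines with knots $t_1,\dots,t_n$: $Q_n$ is the $n\times(n-2)$ matrix with $(Q_n^tv)_k=n(v_k-2v_{k+1}+v_{k+2})$, and $R_n$ is the symmetric tridiagonal $(n-2)\times(n-2)$ matrix with diagonal entries $2/(3n)$ and off-diagonal entries $1/(6n)$ ($\Omega_n=0$ for $n\le 2$). For $\lambda>0$ and $y\in\mathbb R^n$ put $\tilde f_n(\lambda)=\tilde f_n(\lambda;y)=\lambda(\lambda I_n+\Omega_n)^{-1}y$; when no data vector is named, $y=Y_n$. For an interval $I$ let $|I|$ be the number of design points in $I$ and $$w(Y_n,I,\tilde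 f_n(\lambda))=\frac1{\sqrt{|I|}}\sum_{t_i\in I}\bigl(Y(t_i)-\tilde f_n(\lambda)_i\bigr),$$ which is read as $0$ if $|I|=0$. Then the following hold. (0) $\tilde f_n(\lambda)$ is the equal-weight smoothing-spline fit: for all $n$, $y\in\mathbb R^n$ and $\lambda>0$ the criterion $\sum_{i=1}^n\lambda(y_i-g(t_i))^2+\int_0^1 g^{(2)}(t)^2\,dt$ has a minimizer over all $g$ that are differentiable on $[0,1]$ with absolutely continuous derivative and square integrable second derivative, and every minimizer $g$ satisfies $(g(t_1),\dots,g(t_n))^t=\tilde f_n(\lambda;y)$ and $\int_0^1g^{(2)}(t)^2\,dt=\tilde f_n(\lambda;y)^t\Omega_n\tilde f_n(\lambda;y)$. (a) For all $n$ and $y\in\mathbb R^n$, $\tilde f_n(\lambda;y)^t\Omega_n\tilde f_n(\lambda;y)$ is a non-decreasing function of $\lambda>0$, and it is strictly increasing unless there are $a,b\in\mathbb R$ with $y_i=a+bt_i$ for all $i$. (b) $\tilde f_n(\lambda)^t\Omega_n\tilde f_n(\lambda)$ is integrable for all $n$ and $\lambda>0$. There is a constant $c$ (which may depend on $f$ and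 $\sigma$) such that for all $n$ and all $\lambda>0$ $$\mathbb E\bigl(\tilde f_n(\lambda)^t\Omega_n\tilde f_n(\lambda)\bigr)\le\int_0^1f^{(2)}(u)^2\,du+c\,n^{1/4}\lambda^{5/4}.$$ Consequently, for every $a>0$ there is a constant $c$ (which may depend on $a$, $f$ and $\sigma$) such that for all $n\ge1$ and all $\lambda\ge a\,n^{-1/5}$ $$\mathbb E\bigl(\tilde f_n(\lambda)^t\Omega_n\tilde f_n(\lambda)\bigr)\le c\,n^{1/4}\lambda^{5/4}.$$ (c) There is a constant $A>0$ (which may depend on $f$ and $\sigma$) such that for every sequence $\lambda_n$ with $\lambda_n>A/\log n$ for all large $n$, every $q$, every sequence of finite families $\mathcal I_n$ of intervals with $|\mathcal I_n|\le qn$ for all large $n$, and every $\tau>2$, $$\lim_{n\to\infty}\mathbb P\Bigl(\max_{I\in\mathcal I_n}\bigl|w(Y_n,I,\tilde f_n(\lambda_n))\bigr|\le\sigma\sqrt{\tau\log n}\Bigr)=1.$$ -/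

import Mathlib

open MeasureTheory ProbabilityTheory Filter Topology

noncomputable section

namespace SmoothingSpline

/-- The equispaced design points `1/n, 2/n, …, n/n`; the index `i : Fin n` is zero-based. -/
def designPoint (n : ℕ) (i : Fin n) : ℝ := ((i : ℝ) + 1) / n

/-- `g` is continuously differentiable on `[0,1]`, its derivative is absolutely continuous,
and `g2` is a version of its second derivative, which is square integrable on `[0,1]`. -/
def HasL2SecondDeriv (g g2 : ℝ → ℝ) : Prop :=
  MemLp g2 2 (volume.restrict (Set.Icc (0 : ℝ) 1)) ∧
  ∃ g1 : ℝ → ℝ,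
    (∀ t ∈ Set.Icc (0 : ℝ) 1, HasDerivWithinAt g (g1 t) (Set.Icc 0 1) t) ∧
    (∀ t ∈ Set.Icc (0 : ℝ) 1, g1 t - g1 0 = ∫ u in (0 : ℝ)..t, g2 u)

/-- The smoothing-spline criterion with all weights equal to `lam`, for the data `y`, evaluated
at a function `g` with second derivative `g2`. -/
def criterion (n : ℕ) (lam : ℝ) (y : Fin n → ℝ) (g g2 : ℝ → ℝ) : ℝ :=
  ∑ i, lam * (y i - g (designPoint n i)) ^ 2 + ∫ u in (0 : ℝ)..1, g2 u ^ 2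

/-- `g`, with second derivative `g2`, minimizes the equal-weight smoothing-spline criterion. -/
def IsSmoothingSpline (n : ℕ) (lam : ℝ) (y : Fin n → ℝ) (g g2 : ℝ → ℝ) : Prop :=
  HasL2SecondDeriv g g2 ∧
  ∀ h h2 : ℝ → ℝ, HasL2SecondDeriv h h2 → criterion n lam y g g2 ≤ criterion n lam y h h2

/-- The matrix of second differences, scaled by the reciprocal `n` of the spacing of the design.
The column `k` belongs to the `k`-th interior design point, whose zero-based index is `k + 1`. -/
def differenceMatrix (n : ℕ) : Matrix (Fin n) (Fin (n - 2)) ℝ :=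
  Matrix.of fun i k =>
    if (i : ℕ) = k ∨ (i : ℕ) = k + 2 then (n : ℝ)
    else if (i : ℕ) = k + 1 then -2 * (n : ℝ)
    else 0

/-- The Gram matrix in `L²` of the piecewise linear hat functions of height one at the interior
design points. -/
def hatGramMatrix (n : ℕ) : Matrix (Fin (n - 2)) (Fin (n - 2)) ℝ :=
  Matrix.of fun k l =>
    if k = l then 2 / (3 * (n : ℝ))
    else if (k : ℕ) + 1 = l ∨ (l : ℕ) + 1 = k then 1 / (6 * (n : ℝ))
    else 0

/-- The roughness matrix of natural cubic spline interpolation at the design points, in the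
standard form `Q R⁻¹ Qᵀ`. -/
def roughnessMatrix (n : ℕ) : Matrix (Fin n) (Fin n) ℝ :=
  differenceMatrix n * (hatGramMatrix n)⁻¹ * (differenceMatrix n).transpose

/-- The roughness of a vector of values at the design points. -/
def roughness (n : ℕ) (v : Fin n → ℝ) : ℝ :=
  v ⬝ᵥ (roughnessMatrix n).mulVec v

/-- The values at the design points of the equal-weight smoothing-spline fit. -/
def splineFit (n : ℕ) (lam : ℝ) (y : Fin n → ℝ) : Fin n → ℝ :=
  lam • ((lam • (1 : Matrix (Fin n) (Fin n) ℝ) + roughnessMatrix n)⁻¹).mulVec y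

open Classical in
/-- The indices of the design points that lie in `I`. -/
def pointsIn (n : ℕ) (I : Set ℝ) : Finset (Fin n) :=
  Finset.univ.filter fun i => designPoint n i ∈ I

/-- The normalized sum over `I` of the residuals of the data `y` from the fitted values `v`. -/
def residualSum (n : ℕ) (y : Fin n → ℝ) (I : Set ℝ) (v : Fin n → ℝ) : ℝ :=
  1 / √((pointsIn n I).card : ℝ) * ∑ i ∈ pointsIn n I, (y i - v i)

/-- Standard Gaussian white noise on `[0,1]`: independent standard normal random variables. -/
structure IsWhiteNoise {Ω : Type*} [MeasurableSpace Ω] (Z : ℝ → Ω → ℝ) (P : Measure Ω) :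
    Prop where
  gaussian : ∀ t ∈ Set.Icc (0 : ℝ) 1, HasLaw (Z t) (gaussianReal 0 1) P
  indep : iIndepFun (fun t : Set.Icc (0 : ℝ) 1 => Z t) P

/-- The data at the design points generated by `Y(t) = f(t) + σ Z(t)`. -/
def observations {Ω : Type*} (f : ℝ → ℝ) (σ : ℝ) (Z : ℝ → Ω → ℝ) (n : ℕ) (ω : Ω) : Fin n → ℝ :=
  fun i => f (designPoint n i) + σ * Z (designPoint n i) ω

end SmoothingSpline

end

/-!
Write `Ω = Q R⁻¹ Qᵀ` for the roughness matrix, `ρ` for its quadratic form, `v` for the fit to `y`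
and `r = y - v` for the residuals. No spectral decomposition is used: everything follows from the
normal equations `Ω v = lam r` and from quadratic forms.

*The fit is the smoothing spline.* Taylor's formula with the kernel `(t - u)₊` shows that `Qᵀ` turns
the values of a function `g` into the moments of `g''` against the hat functions, whose Gram matrix
is `R`. So the natural spline through given values has as second derivative the `L²` projection of
`g''` onto the hat functions (`HasL2SecondDeriv.roughness_le`, `exists_interpolating_spline`), and
minimizing the criterion over functions reduces to minimizing `lam |y - w|² + ρ w` over vectors,
where completing the square gives the unique minimizer (`penalizedSum_eq_add`).

*Monotonicity.* Comparing the minimizers for two weights with each other in both criteria gives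
monotonicity. If two fits are equally rough, then they agree by uniqueness, and the two normal
equations force `Ω y = 0`, which means that the data lie on a line.

*Expected roughness.* The signal contributes at most `ρ (f) ≤ ∫ f''²`, the noise `σ²` times a
trace. By the normal equations for the second derivatives at the knots, this trace is at most
`lam² / n` times the trace of the inverse of `lam R + Qᵀ Q`, and a diagonal entry of an inverse is
bounded by any constant `κ` with `x k ^ 2 ≤ κ (lam xᵀ R x + |Q x|²)`. A discrete
Gagliardo–Nirenberg inequality provides `κ` of order `n^(1/4) lam^(-3/4)`
(`sq_le_mul_knotMatrix`), which is exactly the rate needed.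

*Residuals.* The residual map is a symmetric contraction, so a normalized sum of residual noise is a
linear form in the noise with coefficient vector of norm at most one, and Gaussian tails with a
union bound over the intervals give the threshold `σ √(τ log n)` for every `τ > 2`. The bias must be
`o(√(log n))`, whereas `lam |r|² ≤ ρ` alone only gives `O(√(log n))`. It is improved by
approximating `f''` in `L²` by a smooth function that vanishes outside `(0, 1)`: the approximation
error has small roughness, and for the smooth part the bound `lam |r| ≤ |Ω g|` is much better
(`HasL2SecondDeriv.exists_residual_sq_le`).
-/

noncomputable section

namespace SmoothingSpline

open Matrix

/-! ### The matrices of second differences and of hat functions -/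

lemma sum_fin_ite_eq_mul {n : ℕ} (w : ℕ → ℝ) (c : ℝ) {j : ℕ} (hj : j < n) :
    ∑ i : Fin n, (if (i : ℕ) = j then c else 0) * w i = c * w j := by
  rw [Finset.sum_eq_single (⟨j, hj⟩ : Fin n)]
  · simp
  · intro b _ hb
    have : (b : ℕ) ≠ j := fun h => hb (Fin.ext h)
    simp [this]
  · simp

lemma differenceMatrix_apply (n : ℕ) (i : Fin n) (k : Fin (n - 2)) :
    differenceMatrix n i k = (if (i : ℕ) = k then (n : ℝ) else 0)
      + (if (i : ℕ) = k + 1 then -2 * (n : ℝ) else 0)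
      + (if (i : ℕ) = k + 2 then (n : ℝ) else 0) := by
  simp only [differenceMatrix, Matrix.of_apply]
  split_ifs <;> first | omega | simp_all

/-- The transposed difference matrix takes second differences of a sequence. -/
lemma transpose_differenceMatrix_mulVec (n : ℕ) (w : ℕ → ℝ) (k : Fin (n - 2)) :
    ((differenceMatrix n)ᵀ *ᵥ fun i => w i) k = n * (w k - 2 * w (k + 1) + w (k + 2)) := by
  have hk := k.2
  simp only [Matrix.mulVec, dotProduct, Matrix.transpose_apply, differenceMatrix_apply, add_mul,
    Finset.sum_add_distrib]
  rw [sum_fin_ite_eq_mul w _ (by omega), sum_fin_ite_eq_mul w _ (by omega),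
    sum_fin_ite_eq_mul w _ (by omega)]
  ring

/-- The vector `x` at the interior design points, extended by zero to all indices. The entry that
belongs to the interior design point `k` sits at the index `k + 2`. -/
def zeroExtend (n : ℕ) (x : Fin (n - 2) → ℝ) (j : ℕ) : ℝ :=
  if h : 2 ≤ j ∧ j < n then x ⟨j - 2, by omega⟩ else 0

lemma zeroExtend_of_lt {n : ℕ} (x : Fin (n - 2) → ℝ) {j : ℕ} (h : j < 2) :
    zeroExtend n x j = 0 := by
  rw [zeroExtend, dif_neg (by omega)]

lemma zeroExtend_of_le {n : ℕ} (x : Fin (n - 2) → ℝ) {j : ℕ} (h : n ≤ j) :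
    zeroExtend n x j = 0 := by
  rw [zeroExtend, dif_neg (by omega)]

lemma zeroExtend_add_two {n : ℕ} (x : Fin (n - 2) → ℝ) (k : Fin (n - 2)) :
    zeroExtend n x (k + 2) = x k := by
  have := k.2
  rw [zeroExtend, dif_pos (by omega)]
  rfl

lemma sum_ite_eq_add_mul {n : ℕ} (x : Fin (n - 2) → ℝ) (c : ℝ) (i d : ℕ) :
    ∑ k : Fin (n - 2), (if i = k + d then c else 0) * x k = c * zeroExtend n x (i + 2 - d) := by
  by_cases h : d ≤ i ∧ i - d < n - 2
  · rw [Finset.sum_eq_single (⟨i - d, h.2⟩ : Fin (n - 2))]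
    · rw [show i + 2 - d = ((⟨i - d, h.2⟩ : Fin (n - 2)) : ℕ) + 2 by simp; omega,
        zeroExtend_add_two]
      rw [if_pos (show i = i - d + d by omega)]
    · intro b _ hb
      have : i ≠ b + d := fun h' => hb (Fin.ext (by simp; omega))
      simp [this]
    · simp
  · rw [Finset.sum_eq_zero, zeroExtend, dif_neg (by omega), mul_zero]
    intro k _
    have := k.2
    rw [if_neg (by omega), zero_mul]

/-- The difference matrix takes second differences of the extension by zero. -/
lemma differenceMatrix_mulVec (n : ℕ) (x : Fin (n - 2) → ℝ) (i : Fin n) :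
    (differenceMatrix n *ᵥ x) i = n * (zeroExtend n x i - 2 * zeroExtend n x (i + 1)
      + zeroExtend n x (i + 2)) := by
  simp only [Matrix.mulVec, dotProduct, differenceMatrix_apply, add_mul, Finset.sum_add_distrib]
  rw [sum_ite_eq_add_mul x _ i 1, sum_ite_eq_add_mul x _ i 2]
  have := sum_ite_eq_add_mul x (n : ℝ) i 0
  simp only [add_zero, Nat.sub_zero] at this
  rw [this]
  simp only [show (i : ℕ) + 2 - 1 = i + 1 by omega, show (i : ℕ) + 2 - 2 = i by omega]
  ring

lemma hatGramMatrix_transpose (n : ℕ) : (hatGramMatrix n)ᵀ = hatGramMatrix n := by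
  ext k l
  simp only [hatGramMatrix, Matrix.transpose_apply, Matrix.of_apply, eq_comm (a := l) (b := k),
    or_comm (a := (l : ℕ) + 1 = k)]

lemma card_adjacent_le (m : ℕ) (k : Fin m) :
    (Finset.univ.filter fun l : Fin m => (k : ℕ) + 1 = l ∨ (l : ℕ) + 1 = k).card ≤ 2 := by
  have h : ((Finset.univ.filter fun l : Fin m => (k : ℕ) + 1 = l ∨ (l : ℕ) + 1 = k).map
      Fin.valEmbedding) ⊆ {(k : ℕ) + 1, (k : ℕ) - 1} := by
    intro j hj
    simp only [Finset.mem_map, Finset.mem_filter, Finset.mem_univ, true_and,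
      Fin.valEmbedding_apply] at hj
    obtain ⟨a, ha, rfl⟩ := hj
    simp only [Finset.mem_insert, Finset.mem_singleton]
    omega
  calc _ = _ := (Finset.card_map _).symm
    _ ≤ _ := Finset.card_le_card h
    _ ≤ 2 := Finset.card_le_two

/-- The path graph has adjacency norm at most two. -/
lemma abs_sum_adjacent_le (m : ℕ) (x : Fin m → ℝ) :
    |∑ k : Fin m, ∑ l : Fin m, if (k : ℕ) + 1 = l ∨ (l : ℕ) + 1 = k then x k * x l else 0| ≤
      2 * (x ⬝ᵥ x) := by
  have key : ∀ k : Fin m, ∑ l : Fin m, (if (k : ℕ) + 1 = l ∨ (l : ℕ) + 1 = k then x k * x k else 0)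
      ≤ 2 * (x k * x k) := by
    intro k
    rw [← Finset.sum_filter, Finset.sum_const, nsmul_eq_mul]
    exact mul_le_mul_of_nonneg_right (by exact_mod_cast card_adjacent_le m k) (mul_self_nonneg _)
  have hs : ∑ k : Fin m, ∑ l : Fin m, (if (k : ℕ) + 1 = l ∨ (l : ℕ) + 1 = k then x k * x k else 0)
      ≤ 2 * (x ⬝ᵥ x) := by
    rw [dotProduct, Finset.mul_sum]
    exact Finset.sum_le_sum fun k _ => key k
  have hs' : ∑ k : Fin m, ∑ l : Fin m, (if (k : ℕ) + 1 = l ∨ (l : ℕ) + 1 = k then x l * x l else 0)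
      ≤ 2 * (x ⬝ᵥ x) := by
    rw [Finset.sum_comm]
    simpa only [or_comm] using hs
  calc _ ≤ ∑ k : Fin m, ∑ l : Fin m, |if (k : ℕ) + 1 = l ∨ (l : ℕ) + 1 = k then x k * x l else 0| :=
        (Finset.abs_sum_le_sum_abs _ _).trans
          (Finset.sum_le_sum fun k _ => Finset.abs_sum_le_sum_abs _ _)
    _ ≤ ∑ k : Fin m, ∑ l : Fin m, (1 / 2) *
        ((if (k : ℕ) + 1 = l ∨ (l : ℕ) + 1 = k then x k * x k else 0)
        + (if (k : ℕ) + 1 = l ∨ (l : ℕ) + 1 = k then x l * x l else 0)) := by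
        refine Finset.sum_le_sum fun k _ => Finset.sum_le_sum fun l _ => ?_
        split_ifs
        · rw [abs_mul]
          nlinarith [sq_nonneg (|x k| - |x l|), abs_mul_abs_self (x k), abs_mul_abs_self (x l)]
        · simp
    _ ≤ 2 * (x ⬝ᵥ x) := by
        simp only [← Finset.mul_sum, Finset.sum_add_distrib]
        linarith

lemma dotProduct_hatGramMatrix_mulVec (n : ℕ) (x : Fin (n - 2) → ℝ) :
    x ⬝ᵥ hatGramMatrix n *ᵥ x = 2 / (3 * n) * (x ⬝ᵥ x) + 1 / (6 * n) *
      ∑ k : Fin (n - 2), ∑ l : Fin (n - 2), if (k : ℕ) + 1 = l ∨ (l : ℕ) + 1 = k then x k * x l else 0 := by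
  simp only [Matrix.mulVec, dotProduct, Finset.mul_sum]
  rw [← Finset.sum_add_distrib]
  refine Finset.sum_congr rfl fun k _ => ?_
  have h : ∀ l : Fin (n - 2), x k * (hatGramMatrix n k l * x l) =
      (if k = l then 2 / (3 * (n : ℝ)) * (x l * x l) else 0) + 1 / (6 * (n : ℝ)) *
        (if (k : ℕ) + 1 = l ∨ (l : ℕ) + 1 = k then x k * x l else 0) := by
    intro l
    simp only [hatGramMatrix, Matrix.of_apply]
    by_cases hkl : k = l
    · subst hkl
      simp
      ring
    · simp only [hkl, if_false, zero_add]
      split_ifs <;> ring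
  simp only [h, Finset.sum_add_distrib, Finset.sum_ite_eq, Finset.mem_univ, if_true]

lemma hatGramMatrix_quadratic_le (n : ℕ) (x : Fin (n - 2) → ℝ) :
    x ⬝ᵥ hatGramMatrix n *ᵥ x ≤ 1 / n * (x ⬝ᵥ x) := by
  rw [dotProduct_hatGramMatrix_mulVec]
  have h := (abs_le.1 (abs_sum_adjacent_le _ x)).2
  have h2 := mul_le_mul_of_nonneg_left h (show (0 : ℝ) ≤ 1 / (6 * n) by positivity)
  calc _ ≤ 2 / (3 * (n : ℝ)) * (x ⬝ᵥ x) + 1 / (6 * n) * (2 * (x ⬝ᵥ x)) := by gcongr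
    _ = _ := by field_simp; ring

lemma le_hatGramMatrix_quadratic (n : ℕ) (x : Fin (n - 2) → ℝ) :
    1 / (3 * n) * (x ⬝ᵥ x) ≤ x ⬝ᵥ hatGramMatrix n *ᵥ x := by
  rw [dotProduct_hatGramMatrix_mulVec]
  have h := (abs_le.1 (abs_sum_adjacent_le _ x)).1
  have h2 := mul_le_mul_of_nonneg_left h (show (0 : ℝ) ≤ 1 / (6 * n) by positivity)
  calc _ = 2 / (3 * (n : ℝ)) * (x ⬝ᵥ x) + 1 / (6 * n) * -(2 * (x ⬝ᵥ x)) := by field_simp; ring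
    _ ≤ _ := by gcongr

lemma dotProduct_self_pos {ι : Type*} [Fintype ι] {x : ι → ℝ} (hx : x ≠ 0) : 0 < x ⬝ᵥ x := by
  simpa using dotProduct_self_star_pos_iff.2 hx

lemma zero_le_dotProduct_self {ι : Type*} [Fintype ι] (x : ι → ℝ) : 0 ≤ x ⬝ᵥ x := by
  simpa using dotProduct_self_star_nonneg x

lemma hatGramMatrix_posDef (n : ℕ) : (hatGramMatrix n).PosDef := by
  refine Matrix.PosDef.of_dotProduct_mulVec_pos ?_ fun {x} hx => ?_
  · rw [Matrix.IsHermitian, Matrix.conjTranspose_eq_transpose_of_trivial, hatGramMatrix_transpose]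
  · have hn : 0 < n := by
      rcases Nat.eq_zero_or_pos n with rfl | h
      · exact absurd (funext fun k => absurd k.2 (by omega)) hx
      · exact h
    have := le_hatGramMatrix_quadratic n x
    have hp := dotProduct_self_pos hx
    simp only [star_trivial]
    refine lt_of_lt_of_le ?_ this
    positivity

/-! ### The roughness matrix -/

lemma roughnessMatrix_mulVec (n : ℕ) (v : Fin n → ℝ) :
    roughnessMatrix n *ᵥ v =
      differenceMatrix n *ᵥ ((hatGramMatrix n)⁻¹ *ᵥ ((differenceMatrix n)ᵀ *ᵥ v)) := by
  simp only [roughnessMatrix, Matrix.mulVec_mulVec, Matrix.mul_assoc]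

lemma roughnessMatrix_posSemidef (n : ℕ) : (roughnessMatrix n).PosSemidef := by
  have := (hatGramMatrix_posDef n).inv.posSemidef.mul_mul_conjTranspose_same (differenceMatrix n)
  rwa [Matrix.conjTranspose_eq_transpose_of_trivial] at this

lemma roughnessMatrix_transpose (n : ℕ) : (roughnessMatrix n)ᵀ = roughnessMatrix n := by
  have := (roughnessMatrix_posSemidef n).1
  rwa [Matrix.IsHermitian, Matrix.conjTranspose_eq_transpose_of_trivial] at this

lemma roughness_nonneg (n : ℕ) (v : Fin n → ℝ) : 0 ≤ roughness n v := by
  simpa [roughness] using (roughnessMatrix_posSemidef n).dotProduct_mulVec_nonneg v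

lemma dotProduct_mulVec_comm_of_transpose {ι : Type*} [Fintype ι] {M : Matrix ι ι ℝ}
    (hM : Mᵀ = M) (x y : ι → ℝ) : x ⬝ᵥ M *ᵥ y = y ⬝ᵥ M *ᵥ x := by
  rw [dotProduct_mulVec, dotProduct_comm, ← Matrix.mulVec_transpose, hM]

lemma roughnessMatrix_symm (n : ℕ) (x y : Fin n → ℝ) :
    x ⬝ᵥ roughnessMatrix n *ᵥ y = y ⬝ᵥ roughnessMatrix n *ᵥ x :=
  dotProduct_mulVec_comm_of_transpose (roughnessMatrix_transpose n) x y

/-- The vector `(hatGramMatrix n)⁻¹ Qᵀ v` of second derivatives at the interior design points of the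
natural cubic spline through the values `v`. -/
def knotSecondDeriv (n : ℕ) (v : Fin n → ℝ) : Fin (n - 2) → ℝ :=
  (hatGramMatrix n)⁻¹ *ᵥ ((differenceMatrix n)ᵀ *ᵥ v)

lemma hatGramMatrix_mulVec_knotSecondDeriv (n : ℕ) (v : Fin n → ℝ) :
    hatGramMatrix n *ᵥ knotSecondDeriv n v = (differenceMatrix n)ᵀ *ᵥ v := by
  have h := (Matrix.isUnit_iff_isUnit_det _).1 (hatGramMatrix_posDef n).isUnit
  rw [knotSecondDeriv, Matrix.mulVec_mulVec, Matrix.mul_nonsing_inv _ h, Matrix.one_mulVec]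

lemma knotSecondDeriv_eq {n : ℕ} {v : Fin n → ℝ} {γ : Fin (n - 2) → ℝ}
    (h : (differenceMatrix n)ᵀ *ᵥ v = hatGramMatrix n *ᵥ γ) : knotSecondDeriv n v = γ := by
  have hu := (Matrix.isUnit_iff_isUnit_det _).1 (hatGramMatrix_posDef n).isUnit
  rw [knotSecondDeriv, h, Matrix.mulVec_mulVec, Matrix.nonsing_inv_mul _ hu, Matrix.one_mulVec]

lemma roughnessMatrix_mulVec_eq (n : ℕ) (v : Fin n → ℝ) :
    roughnessMatrix n *ᵥ v = differenceMatrix n *ᵥ knotSecondDeriv n v :=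
  roughnessMatrix_mulVec n v

lemma dotProduct_transpose_mulVec {ι κ : Type*} [Fintype ι] [Fintype κ] (M : Matrix ι κ ℝ)
    (x : ι → ℝ) (y : κ → ℝ) : x ⬝ᵥ M *ᵥ y = (Mᵀ *ᵥ x) ⬝ᵥ y := by
  rw [dotProduct_mulVec, ← Matrix.mulVec_transpose]

lemma roughness_eq_dotProduct (n : ℕ) (v : Fin n → ℝ) :
    roughness n v = ((differenceMatrix n)ᵀ *ᵥ v) ⬝ᵥ knotSecondDeriv n v := by
  rw [roughness, roughnessMatrix_mulVec_eq, dotProduct_transpose_mulVec]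

lemma roughness_eq_quadratic (n : ℕ) (v : Fin n → ℝ) :
    roughness n v = knotSecondDeriv n v ⬝ᵥ hatGramMatrix n *ᵥ knotSecondDeriv n v := by
  rw [roughness_eq_dotProduct, hatGramMatrix_mulVec_knotSecondDeriv, dotProduct_comm]

/-- Values with vanishing second differences lie on a line. -/
lemma exists_affine_of_differences_eq_zero {n : ℕ} {v : Fin n → ℝ}
    (h : (differenceMatrix n)ᵀ *ᵥ v = 0) : ∃ a b : ℝ, ∀ i, v i = a + b * designPoint n i := by
  rcases Nat.eq_zero_or_pos n with rfl | hn
  · exact ⟨0, 0, fun i => i.elim0⟩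
  have hn' : (n : ℝ) ≠ 0 := by positivity
  let w : ℕ → ℝ := fun j => if hj : j < n then v ⟨j, hj⟩ else 0
  have hw : (fun i : Fin n => w i) = v := by
    ext i
    simp [w]
  have hd : ∀ k, k + 2 < n → w (k + 2) = 2 * w (k + 1) - w k := by
    intro k hk
    have h1 := transpose_differenceMatrix_mulVec n w ⟨k, by omega⟩
    rw [hw, h] at h1
    have : w k - 2 * w (k + 1) + w (k + 2) = 0 := by
      simpa [hn'] using h1.symm
    linarith
  have hl : ∀ j, (j < n → w j = w 0 + j * (w 1 - w 0)) ∧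
      (j + 1 < n → w (j + 1) = w 0 + (j + 1) * (w 1 - w 0)) := by
    intro j
    induction j with
    | zero => exact ⟨fun _ => by simp, fun _ => by simp⟩
    | succ j ih =>
      refine ⟨fun hj => by rw [ih.2 hj]; push_cast; ring, fun hj => ?_⟩
      rw [hd j hj, ih.2 (by omega), ih.1 (by omega)]
      push_cast
      ring
  refine ⟨w 0 - (w 1 - w 0), n * (w 1 - w 0), fun i => ?_⟩
  have h1 := (hl i).1 i.2
  rw [← hw]
  simp only [h1, designPoint]
  field_simp
  ring

lemma roughnessMatrix_mulVec_eq_zero {n : ℕ} {v : Fin n → ℝ}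
    (h : roughnessMatrix n *ᵥ v = 0) : (differenceMatrix n)ᵀ *ᵥ v = 0 := by
  have h1 : roughness n v = 0 := by rw [roughness, h, dotProduct_zero]
  rw [← hatGramMatrix_mulVec_knotSecondDeriv]
  by_contra hne
  have hx : knotSecondDeriv n v ≠ 0 := fun h0 => hne (by rw [h0, Matrix.mulVec_zero])
  have := (hatGramMatrix_posDef n).dotProduct_mulVec_pos hx
  rw [star_trivial, ← roughness_eq_quadratic, h1] at this
  exact lt_irrefl _ this

/-! ### The fitted values -/

lemma smoothingMatrix_posDef (n : ℕ) {lam : ℝ} (hl : 0 < lam) :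
    (lam • (1 : Matrix (Fin n) (Fin n) ℝ) + roughnessMatrix n).PosDef :=
  (Matrix.PosDef.one.smul hl).add_posSemidef (roughnessMatrix_posSemidef n)

/-- The normal equations of the smoothing spline. -/
lemma roughnessMatrix_mulVec_splineFit (n : ℕ) {lam : ℝ} (hl : 0 < lam) (y : Fin n → ℝ) :
    roughnessMatrix n *ᵥ splineFit n lam y = lam • (y - splineFit n lam y) := by
  have hu := (Matrix.isUnit_iff_isUnit_det _).1 (smoothingMatrix_posDef n hl).isUnit
  have h : (lam • (1 : Matrix (Fin n) (Fin n) ℝ) + roughnessMatrix n) *ᵥ splineFit n lam y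
      = lam • y := by
    rw [splineFit, Matrix.mulVec_smul, Matrix.mulVec_mulVec, Matrix.mul_nonsing_inv _ hu,
      Matrix.one_mulVec]
  rw [Matrix.add_mulVec, Matrix.smul_mulVec, Matrix.one_mulVec] at h
  rw [smul_sub, ← h]
  abel

/-- The penalized least squares criterion on vectors of values at the design points. -/
def penalizedSum (n : ℕ) (lam : ℝ) (y w : Fin n → ℝ) : ℝ :=
  lam * ((y - w) ⬝ᵥ (y - w)) + roughness n w

lemma roughness_add (n : ℕ) (v d : Fin n → ℝ) :
    roughness n (v + d) = roughness n v + 2 * (d ⬝ᵥ roughnessMatrix n *ᵥ v) + roughness n d := by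
  simp only [roughness, Matrix.mulVec_add, dotProduct_add, add_dotProduct,
    roughnessMatrix_symm n v d]
  ring

lemma penalizedSum_eq_add (n : ℕ) {lam : ℝ} (hl : 0 < lam) (y w : Fin n → ℝ) :
    penalizedSum n lam y w = penalizedSum n lam y (splineFit n lam y)
      + lam * ((w - splineFit n lam y) ⬝ᵥ (w - splineFit n lam y))
      + roughness n (w - splineFit n lam y) := by
  set v := splineFit n lam y with hv
  have h1 := roughness_add n v (w - v)
  rw [roughnessMatrix_mulVec_splineFit n hl y, ← hv, dotProduct_smul, smul_eq_mul,
    add_sub_cancel] at h1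
  rw [penalizedSum, penalizedSum, h1]
  have h2 : y - w = (y - v) - (w - v) := by abel
  rw [h2]
  simp only [sub_dotProduct, dotProduct_sub, dotProduct_comm y v, dotProduct_comm w v,
    dotProduct_comm y w]
  ring

lemma penalizedSum_splineFit_le (n : ℕ) {lam : ℝ} (hl : 0 < lam) (y w : Fin n → ℝ) :
    penalizedSum n lam y (splineFit n lam y) ≤ penalizedSum n lam y w := by
  rw [penalizedSum_eq_add n hl y w]
  have h1 := mul_nonneg hl.le (zero_le_dotProduct_self (w - splineFit n lam y))
  have h2 := roughness_nonneg n (w - splineFit n lam y)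
  linarith

lemma eq_splineFit_of_penalizedSum_le {n : ℕ} {lam : ℝ} (hl : 0 < lam) {y w : Fin n → ℝ}
    (h : penalizedSum n lam y w ≤ penalizedSum n lam y (splineFit n lam y)) :
    w = splineFit n lam y := by
  rw [penalizedSum_eq_add n hl y w] at h
  by_contra hne
  have h1 := mul_pos hl (dotProduct_self_pos (sub_ne_zero.2 hne))
  have h2 := roughness_nonneg n (w - splineFit n lam y)
  linarith

lemma penalizedSum_self (n : ℕ) (lam : ℝ) (y : Fin n → ℝ) :
    penalizedSum n lam y y = roughness n y := by
  simp [penalizedSum]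

lemma roughness_splineFit_le (n : ℕ) {lam : ℝ} (hl : 0 < lam) (y : Fin n → ℝ) :
    roughness n (splineFit n lam y) ≤ roughness n y := by
  have h := penalizedSum_splineFit_le n hl y y
  rw [penalizedSum_self, penalizedSum] at h
  have h1 := mul_nonneg hl.le (zero_le_dotProduct_self (y - splineFit n lam y))
  linarith

/-- The residual vector of the fit. -/
def residual (n : ℕ) (lam : ℝ) (y : Fin n → ℝ) : Fin n → ℝ := y - splineFit n lam y

lemma splineFit_add (n : ℕ) (lam : ℝ) (x y : Fin n → ℝ) :
    splineFit n lam (x + y) = splineFit n lam x + splineFit n lam y := by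
  simp [splineFit, Matrix.mulVec_add]

lemma splineFit_smul (n : ℕ) (lam c : ℝ) (x : Fin n → ℝ) :
    splineFit n lam (c • x) = c • splineFit n lam x := by
  simp [splineFit, Matrix.mulVec_smul, smul_comm lam c]

lemma residual_add (n : ℕ) (lam : ℝ) (x y : Fin n → ℝ) :
    residual n lam (x + y) = residual n lam x + residual n lam y := by
  simp only [residual, splineFit_add]
  abel

lemma residual_smul (n : ℕ) (lam c : ℝ) (x : Fin n → ℝ) :
    residual n lam (c • x) = c • residual n lam x := by
  simp only [residual, splineFit_smul, smul_sub]

lemma mul_residual_sq_le_roughness (n : ℕ) {lam : ℝ} (hl : 0 < lam) (y : Fin n → ℝ) :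
    lam * (residual n lam y ⬝ᵥ residual n lam y) ≤ roughness n y := by
  have h := penalizedSum_splineFit_le n hl y y
  rw [penalizedSum_self, penalizedSum] at h
  have := roughness_nonneg n (splineFit n lam y)
  rw [residual]
  linarith

lemma residual_sq_le (n : ℕ) {lam : ℝ} (hl : 0 < lam) (y : Fin n → ℝ) :
    residual n lam y ⬝ᵥ residual n lam y ≤ y ⬝ᵥ y := by
  have h1 : splineFit n lam y ⬝ᵥ roughnessMatrix n *ᵥ splineFit n lam y
      = lam * (splineFit n lam y ⬝ᵥ residual n lam y) := by
    rw [roughnessMatrix_mulVec_splineFit n hl, dotProduct_smul, smul_eq_mul, residual]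
  have h2 : 0 ≤ splineFit n lam y ⬝ᵥ residual n lam y :=
    nonneg_of_mul_nonneg_right (h1 ▸ roughness_nonneg n _) hl
  have h3 : y = splineFit n lam y + residual n lam y := by
    rw [residual]
    abel
  have h4 := zero_le_dotProduct_self (splineFit n lam y)
  conv_rhs => rw [h3]
  simp only [add_dotProduct, dotProduct_add, dotProduct_comm (residual n lam y) (splineFit n lam y)]
  linarith

lemma dotProduct_sq_le {ι : Type*} [Fintype ι] (x y : ι → ℝ) :
    (x ⬝ᵥ y) ^ 2 ≤ (x ⬝ᵥ x) * (y ⬝ᵥ y) := by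
  have := Finset.sum_mul_sq_le_sq_mul_sq Finset.univ x y
  simpa only [dotProduct, pow_two] using this

lemma sq_mul_residual_sq_le (n : ℕ) {lam : ℝ} (hl : 0 < lam) (y : Fin n → ℝ) :
    lam ^ 2 * (residual n lam y ⬝ᵥ residual n lam y) ≤
      (roughnessMatrix n *ᵥ y) ⬝ᵥ (roughnessMatrix n *ᵥ y) := by
  set r := residual n lam y with hr
  have h0 : lam • r = roughnessMatrix n *ᵥ y - roughnessMatrix n *ᵥ r := by
    rw [hr, residual, ← roughnessMatrix_mulVec_splineFit n hl, Matrix.mulVec_sub]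
    abel
  have h1 : lam * (r ⬝ᵥ r) = r ⬝ᵥ roughnessMatrix n *ᵥ y - roughness n r := by
    rw [roughness, ← dotProduct_sub, ← h0, dotProduct_smul, smul_eq_mul]
  have h2 := roughness_nonneg n r
  have h3 : lam * (r ⬝ᵥ r) ≤ r ⬝ᵥ roughnessMatrix n *ᵥ y := by linarith
  have h4 := dotProduct_sq_le r (roughnessMatrix n *ᵥ y)
  have h5 := zero_le_dotProduct_self r
  rcases h5.eq_or_lt with h6 | h6
  · rw [← h6, mul_zero]
    exact zero_le_dotProduct_self _
  · refine le_of_mul_le_mul_left ?_ h6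
    calc _ = (lam * (r ⬝ᵥ r)) ^ 2 := by ring
      _ ≤ (r ⬝ᵥ roughnessMatrix n *ᵥ y) ^ 2 := by gcongr
      _ ≤ _ := h4

/-! ### Monotonicity of the roughness in the weight -/

/-- With a larger weight the fit is at least as rough and at least as close to the data. -/
lemma roughness_splineFit_mono_aux (n : ℕ) (y : Fin n → ℝ) {l₁ l₂ : ℝ} (h1 : 0 < l₁)
    (h12 : l₁ < l₂) :
    0 ≤ residual n l₁ y ⬝ᵥ residual n l₁ y - residual n l₂ y ⬝ᵥ residual n l₂ y ∧
    l₁ * (residual n l₁ y ⬝ᵥ residual n l₁ y - residual n l₂ y ⬝ᵥ residual n l₂ y)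
      ≤ roughness n (splineFit n l₂ y) - roughness n (splineFit n l₁ y) := by
  have a := penalizedSum_splineFit_le n h1 y (splineFit n l₂ y)
  have b := penalizedSum_splineFit_le n (h1.trans h12) y (splineFit n l₁ y)
  simp only [penalizedSum] at a b
  simp only [residual]
  constructor <;> nlinarith

lemma monotoneOn_roughness_splineFit (n : ℕ) (y : Fin n → ℝ) :
    MonotoneOn (fun lam : ℝ => roughness n (splineFit n lam y)) (Set.Ioi 0) := by
  intro l₁ h1 l₂ _ h12
  rcases h12.eq_or_lt with rfl | h12
  · exact le_rfl
  have := roughness_splineFit_mono_aux n y h1 h12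
  have := mul_nonneg (le_of_lt h1) this.1
  dsimp only
  linarith

/-- If two weights give equally rough fits, then by uniqueness of the minimizer the fits agree, so
the normal equations for both weights make the data reproduce themselves without roughness. -/
lemma strictMonoOn_roughness_splineFit {n : ℕ} {y : Fin n → ℝ}
    (hy : ¬ ∃ a b : ℝ, ∀ i, y i = a + b * designPoint n i) :
    StrictMonoOn (fun lam : ℝ => roughness n (splineFit n lam y)) (Set.Ioi 0) := by
  intro l₁ h1 l₂ h2 h12
  refine lt_of_le_of_ne (monotoneOn_roughness_splineFit n y h1 h2 h12.le) fun heq => hy ?_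
  rw [Set.mem_Ioi] at h1 h2
  obtain ⟨ha, hb⟩ := roughness_splineFit_mono_aux n y h1 h12
  dsimp only at heq
  have hd : residual n l₁ y ⬝ᵥ residual n l₁ y = residual n l₂ y ⬝ᵥ residual n l₂ y := by
    nlinarith
  have hv : splineFit n l₂ y = splineFit n l₁ y := by
    refine eq_splineFit_of_penalizedSum_le h1 ?_
    simp only [residual] at hd
    rw [penalizedSum, penalizedSum, hd, heq]
  have e1 := roughnessMatrix_mulVec_splineFit n h1 y
  have e2 := roughnessMatrix_mulVec_splineFit n h2 y
  rw [hv] at e2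
  have e3 : (l₂ - l₁) • (y - splineFit n l₁ y) = 0 := by
    rw [sub_smul, ← e1, ← e2, sub_self]
  have e4 : y - splineFit n l₁ y = 0 :=
    (smul_eq_zero.1 e3).resolve_left (sub_ne_zero.2 h12.ne')
  rw [e4, smul_zero, ← sub_eq_zero.1 e4] at e1
  exact exists_affine_of_differences_eq_zero (roughnessMatrix_mulVec_eq_zero e1)

/-! ### Functions with a square integrable second derivative -/

lemma designPoint_mem_Icc {n : ℕ} (i : Fin n) : designPoint n i ∈ Set.Icc (0 : ℝ) 1 := by
  have hn : (0 : ℝ) < n := by exact_mod_cast i.pos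
  have hi : (i : ℝ) + 1 ≤ n := by exact_mod_cast i.2
  exact ⟨by rw [designPoint]; positivity, by rw [designPoint, div_le_one hn]; exact hi⟩

lemma HasL2SecondDeriv.intervalIntegrable {g g2 : ℝ → ℝ} (h : HasL2SecondDeriv g g2) :
    IntervalIntegrable g2 volume 0 1 := by
  rw [intervalIntegrable_iff_integrableOn_Icc_of_le zero_le_one]
  exact h.1.integrable (by norm_num)

lemma HasL2SecondDeriv.intervalIntegrable_sq {g g2 : ℝ → ℝ} (h : HasL2SecondDeriv g g2) :
    IntervalIntegrable (fun u => g2 u ^ 2) volume 0 1 := by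
  rw [intervalIntegrable_iff_integrableOn_Icc_of_le zero_le_one]
  exact h.1.integrable_sq

lemma hasL2SecondDeriv_of_hasDerivAt {g g1 g2 : ℝ → ℝ} (h1 : ∀ t, HasDerivAt g (g1 t) t)
    (h2 : ∀ t, HasDerivAt g1 (g2 t) t) (hc : Continuous g2) : HasL2SecondDeriv g g2 := by
  refine ⟨?_, g1, fun t _ => (h1 t).hasDerivWithinAt, fun t _ => ?_⟩
  · exact (memLp_two_iff_integrable_sq hc.aestronglyMeasurable).2
      (hc.pow 2).continuousOn.integrableOn_Icc
  · rw [intervalIntegral.integral_eq_sub_of_hasDerivAt (fun x _ => h2 x)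
      (hc.intervalIntegrable _ _)]

lemma HasL2SecondDeriv.add_affine {g g2 : ℝ → ℝ} (h : HasL2SecondDeriv g g2) (a b : ℝ) :
    HasL2SecondDeriv (fun t => g t + (a + b * t)) g2 := by
  obtain ⟨hm, g1, hg, hg1⟩ := h
  refine ⟨hm, fun t => g1 t + b, fun t ht => ?_, fun t ht => ?_⟩
  · have d := (hg t ht).add ((((hasDerivAt_id t).const_mul b).const_add a).hasDerivWithinAt)
    rw [mul_one] at d
    exact d
  · rw [← hg1 t ht]
    ring

lemma HasL2SecondDeriv.sub {g g2 h h2 : ℝ → ℝ} (hg : HasL2SecondDeriv g g2)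
    (hh : HasL2SecondDeriv h h2) : HasL2SecondDeriv (fun t => g t - h t) (fun t => g2 t - h2 t) := by
  have ig := hg.intervalIntegrable
  have ih := hh.intervalIntegrable
  obtain ⟨hgm, g1, hg, hg1⟩ := hg
  obtain ⟨hhm, h1, hh, hh1⟩ := hh
  refine ⟨hgm.sub hhm, fun t => g1 t - h1 t, fun t ht => (hg t ht).sub (hh t ht), fun t ht => ?_⟩
  have hs : Set.uIcc 0 t ⊆ Set.uIcc (0 : ℝ) 1 := by
    rw [Set.uIcc_of_le ht.1, Set.uIcc_of_le zero_le_one]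
    exact Set.Icc_subset_Icc_right ht.2
  rw [intervalIntegral.integral_sub (ig.mono_set hs) (ih.mono_set hs), ← hg1 t ht, ← hh1 t ht]
  ring

/-- Taylor's formula with integral remainder, the kernel `(t - u)₊` being integrated over the
whole interval so that its dependence on `t` is explicit. -/
lemma HasL2SecondDeriv.taylor {g g2 : ℝ → ℝ} (h : HasL2SecondDeriv g g2) :
    ∃ b : ℝ, ∀ t ∈ Set.Icc (0 : ℝ) 1,
      g t = g 0 + b * t + ∫ u in (0 : ℝ)..1, max (t - u) 0 * g2 u := by
  have ig := h.intervalIntegrable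
  obtain ⟨_, g1, hg, hg1⟩ := h
  refine ⟨g1 0, fun t ht => ?_⟩
  have hs : Set.uIcc 0 t ⊆ Set.uIcc (0 : ℝ) 1 := by
    rw [Set.uIcc_of_le ht.1, Set.uIcc_of_le zero_le_one]
    exact Set.Icc_subset_Icc_right ht.2
  have hs' : Set.uIcc t 1 ⊆ Set.uIcc (0 : ℝ) 1 := by
    rw [Set.uIcc_of_le ht.2, Set.uIcc_of_le zero_le_one]
    exact Set.Icc_subset_Icc_left ht.1
  have igt := ig.mono_set hs
  set H : ℝ → ℝ := fun x => ∫ u in (0 : ℝ)..x, g2 u with hH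
  have hac : AbsolutelyContinuousOnInterval H 0 t :=
    igt.absolutelyContinuousOnInterval_intervalIntegral (by simp)
  have hHc : ContinuousOn H (Set.uIcc 0 t) := hac.continuousOn
  have hg1H : ∀ x ∈ Set.uIcc 0 t, g1 x = g1 0 + H x := by
    intro x hx
    rw [Set.uIcc_of_le ht.1] at hx
    linarith [hg1 x ⟨hx.1, hx.2.trans ht.2⟩]
  have hparts := AbsolutelyContinuousOnInterval.integral_mul_deriv_eq_deriv_mul
    (f := fun x => t - x) (g := H) (a := 0) (b := t)
    (ContDiffOn.absolutelyContinuousOnInterval (by fun_prop)) hac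
  have hd : ∫ x in (0 : ℝ)..t, (t - x) * deriv H x = ∫ x in (0 : ℝ)..t, (t - x) * g2 x := by
    refine intervalIntegral.integral_congr_ae ?_
    filter_upwards [igt.ae_hasDerivAt_integral] with x hx hxt
    rw [(hx (Set.uIoc_subset_uIcc hxt) 0 (by simp)).deriv]
  have hderiv : ∀ x : ℝ, deriv (fun x => t - x) x = -1 := fun x => by
    simp
  have hH0 : H 0 = 0 := by simp [hH]
  rw [hd] at hparts
  simp only [hderiv, hH0, sub_self, zero_mul, mul_zero, neg_one_mul, intervalIntegral.integral_neg,
    sub_neg_eq_add, zero_add] at hparts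
  have hftc : ∫ x in (0 : ℝ)..t, g1 x = g t - g 0 := by
    refine intervalIntegral.integral_eq_sub_of_hasDeriv_right_of_le ht.1
      (fun x hx => ((hg x ⟨hx.1, hx.2.trans ht.2⟩).continuousWithinAt).mono
        (Set.Icc_subset_Icc_right ht.2)) (fun x hx => ?_) ?_
    · exact ((hg x ⟨hx.1.le, hx.2.le.trans ht.2⟩).hasDerivAt
        (Icc_mem_nhds hx.1 (hx.2.trans_le ht.2))).hasDerivWithinAt
    · exact ContinuousOn.intervalIntegrable
        ((hHc.const_add (g1 0)).congr hg1H)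
  have hftc2 : ∫ x in (0 : ℝ)..t, g1 x = g1 0 * t + ∫ x in (0 : ℝ)..t, H x := by
    rw [intervalIntegral.integral_congr hg1H, intervalIntegral.integral_add
      intervalIntegrable_const hHc.intervalIntegrable]
    simp [mul_comm]
  have hsplit : ∫ u in (0 : ℝ)..1, max (t - u) 0 * g2 u = ∫ u in (0 : ℝ)..t, (t - u) * g2 u := by
    have ii : IntervalIntegrable (fun u => max (t - u) 0 * g2 u) volume 0 1 :=
      ig.continuousOn_mul (by fun_prop)
    rw [← intervalIntegral.integral_add_adjacent_intervals (ii.mono_set hs) (ii.mono_set hs')]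
    have z : ∫ u in t..1, max (t - u) 0 * g2 u = 0 := by
      rw [intervalIntegral.integral_congr (g := fun _ => (0 : ℝ)), intervalIntegral.integral_zero]
      intro u hu
      rw [Set.uIcc_of_le ht.2] at hu
      simp [max_eq_right (sub_nonpos.2 hu.1)]
    rw [z, add_zero]
    refine intervalIntegral.integral_congr fun u hu => ?_
    rw [Set.uIcc_of_le ht.1] at hu
    simp [max_eq_left (sub_nonneg.2 hu.2)]
  rw [hsplit, hparts]
  linarith

/-! ### Hat functions -/

/-- The hat function of height one at the interior design point `(k + 2) / n`, written as a scaled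
second difference of the truncated linear functions `(t - u)₊`. -/
def hat (n k : ℕ) (u : ℝ) : ℝ :=
  n * (max (((k : ℝ) + 1) / n - u) 0 - 2 * max (((k : ℝ) + 2) / n - u) 0
    + max (((k : ℝ) + 3) / n - u) 0)

lemma continuous_hat (n k : ℕ) : Continuous (hat n k) := by
  unfold hat
  fun_prop

/-- Second differences of the values of a function are the moments of its second derivative
against the hat functions. -/
lemma HasL2SecondDeriv.differences_eq {g g2 : ℝ → ℝ} (h : HasL2SecondDeriv g g2) (n : ℕ)
    (k : Fin (n - 2)) :
    ((differenceMatrix n)ᵀ *ᵥ fun i => g (designPoint n i)) k =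
      ∫ u in (0 : ℝ)..1, hat n k u * g2 u := by
  obtain ⟨b, hb⟩ := h.taylor
  have hk := k.2
  have e := transpose_differenceMatrix_mulVec n (fun j => g (((j : ℝ) + 1) / n)) k
  have m : ∀ j : ℕ, j < n → ((j : ℝ) + 1) / n ∈ Set.Icc (0 : ℝ) 1 := fun j hj =>
    designPoint_mem_Icc (⟨j, hj⟩ : Fin n)
  have e' : (fun i : Fin n => g (designPoint n i)) = fun i : Fin n => g (((i : ℝ) + 1) / n) := rfl
  rw [e', e, hb _ (m k (by omega)), hb _ (m (k + 1) (by omega)), hb _ (m (k + 2) (by omega))]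
  have i : ∀ c : ℝ, IntervalIntegrable (fun u => max (c - u) 0 * g2 u) volume 0 1 := fun c =>
    h.intervalIntegrable.continuousOn_mul (by fun_prop)
  have hh : ∀ u, hat n k u * g2 u = n * (max (((k : ℝ) + 1) / n - u) 0 * g2 u
      - 2 * (max (((k : ℝ) + 2) / n - u) 0 * g2 u) + max (((k : ℝ) + 3) / n - u) 0 * g2 u) := by
    intro u
    rw [hat]
    ring
  simp only [hh]
  rw [intervalIntegral.integral_const_mul, intervalIntegral.integral_add
    ((i _).sub ((i _).const_mul 2)) (i _), intervalIntegral.integral_sub (i _) ((i _).const_mul 2),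
    intervalIntegral.integral_const_mul]
  push_cast
  rw [show (k : ℝ) + 1 + 1 = k + 2 by ring, show (k : ℝ) + 2 + 1 = k + 3 by ring]
  ring

lemma hasDerivAt_max_pow (m : ℕ) (a t : ℝ) :
    HasDerivAt (fun t => max (t - a) 0 ^ (m + 2)) ((m + 2 : ℕ) * max (t - a) 0 ^ (m + 1)) t := by
  have hne : ∀ y ≠ a, HasDerivAt (fun t => max (t - a) 0 ^ (m + 2))
      ((m + 2 : ℕ) * max (y - a) 0 ^ (m + 1)) y := by
    intro y hy
    rcases lt_or_gt_of_ne hy with hy | hy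
    · rw [max_eq_right (by linarith), zero_pow (by omega), mul_zero]
      refine (hasDerivAt_const y (0 : ℝ)).congr_of_eventuallyEq ?_
      filter_upwards [gt_mem_nhds hy] with z hz
      rw [max_eq_right (by linarith), zero_pow (by omega)]
    · rw [max_eq_left (by linarith)]
      have h := ((hasDerivAt_id y).sub_const a).pow (m + 2)
      simp only [id, mul_one] at h
      refine HasDerivAt.congr_of_eventuallyEq h ?_
      filter_upwards [lt_mem_nhds hy] with z hz
      rw [max_eq_left (by linarith)]
      rfl
  rcases eq_or_ne t a with rfl | h
  · exact hasDerivAt_of_hasDerivAt_of_ne hne (by fun_prop) (by fun_prop)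
  · exact hne t h

/-- An explicit second antiderivative of a hat function, a combination of truncated cubics. -/
def hatSpline (n l : ℕ) (t : ℝ) : ℝ :=
  n / 6 * (max (t - ((l : ℝ) + 1) / n) 0 ^ 3 - 2 * max (t - ((l : ℝ) + 2) / n) 0 ^ 3
    + max (t - ((l : ℝ) + 3) / n) 0 ^ 3)

lemma max_neg_eq (x : ℝ) : max x 0 = x + max (-x) 0 := by
  rcases le_total 0 x with h | h
  · rw [max_eq_left h, max_eq_right (by linarith)]; ring
  · rw [max_eq_right h, max_eq_left (by linarith)]; ring

lemma hasL2SecondDeriv_hatSpline (n l : ℕ) : HasL2SecondDeriv (hatSpline n l) (hat n l) := by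
  refine hasL2SecondDeriv_of_hasDerivAt (g1 := fun t =>
    n / 2 * (max (t - ((l : ℝ) + 1) / n) 0 ^ 2 - 2 * max (t - ((l : ℝ) + 2) / n) 0 ^ 2
    + max (t - ((l : ℝ) + 3) / n) 0 ^ 2)) (fun t => ?_) (fun t => ?_) (continuous_hat n l)
  · have d := (((hasDerivAt_max_pow 1 (((l : ℝ) + 1) / n) t).sub
      ((hasDerivAt_max_pow 1 (((l : ℝ) + 2) / n) t).const_mul 2)).add
      (hasDerivAt_max_pow 1 (((l : ℝ) + 3) / n) t)).const_mul ((n : ℝ) / 6)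
    refine d.congr_deriv ?_
    push_cast
    ring
  · have d := (((hasDerivAt_max_pow 0 (((l : ℝ) + 1) / n) t).sub
      ((hasDerivAt_max_pow 0 (((l : ℝ) + 2) / n) t).const_mul 2)).add
      (hasDerivAt_max_pow 0 (((l : ℝ) + 3) / n) t)).const_mul ((n : ℝ) / 2)
    refine d.congr_deriv ?_
    -- truncation from the left and from the right differ by second differences of a linear function
    rw [hat, max_neg_eq (((l : ℝ) + 1) / n - t), max_neg_eq (((l : ℝ) + 2) / n - t),
      max_neg_eq (((l : ℝ) + 3) / n - t)]
    simp only [neg_sub]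
    push_cast
    ring

lemma fourth_difference_truncated_cubic (d : ℤ) :
    max ((d : ℝ) + 2) 0 ^ 3 - 4 * max ((d : ℝ) + 1) 0 ^ 3 + 6 * max (d : ℝ) 0 ^ 3
      - 4 * max ((d : ℝ) - 1) 0 ^ 3 + max ((d : ℝ) - 2) 0 ^ 3
      = if d = 0 then 4 else if d = 1 ∨ d = -1 then 1 else 0 := by
  rcases lt_trichotomy d 0 with h | rfl | h
  · rcases (show d = -1 ∨ d ≤ -2 by omega) with rfl | h
    · norm_num
    · have h' : (d : ℝ) ≤ -2 := by exact_mod_cast h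
      rw [if_neg (by omega), if_neg (by omega), max_eq_right (by linarith),
        max_eq_right (by linarith), max_eq_right (by linarith), max_eq_right (by linarith),
        max_eq_right (by linarith)]
      norm_num
  · norm_num
  · rcases (show d = 1 ∨ 2 ≤ d by omega) with rfl | h
    · norm_num
    · have h' : (2 : ℝ) ≤ d := by exact_mod_cast h
      rw [if_neg (by omega), if_neg (by omega), max_eq_left (by linarith),
        max_eq_left (by linarith), max_eq_left (by linarith), max_eq_left (by linarith),
        max_eq_left (by linarith)]
      ring

lemma max_div_pow (x c : ℝ) (hc : 0 < c) : max (x / c) 0 ^ 3 = max x 0 ^ 3 / c ^ 3 := by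
  rw [← div_pow, ← max_div_div_right hc.le, zero_div]

lemma integral_hat_mul_hat (n : ℕ) (k l : Fin (n - 2)) :
    ∫ u in (0 : ℝ)..1, hat n k u * hat n l u = hatGramMatrix n k l := by
  have hn : (0 : ℝ) < n := by
    have := k.2
    exact_mod_cast (by omega : 0 < n)
  have hk := k.2
  rw [← (hasL2SecondDeriv_hatSpline n l).differences_eq n k]
  have e := transpose_differenceMatrix_mulVec n (fun j => hatSpline n l (((j : ℝ) + 1) / n)) k
  have e' : (fun i : Fin n => hatSpline n l (designPoint n i))
    = fun i : Fin n => hatSpline n l (((i : ℝ) + 1) / n) := rfl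
  rw [e', e]
  have hm : ∀ a b : ℝ, max (a / n - b / n) 0 ^ 3 = max (a - b) 0 ^ 3 / n ^ 3 := by
    intro a b
    rw [← sub_div, max_div_pow _ _ hn]
  have h4 := fourth_difference_truncated_cubic ((k : ℤ) - l)
  push_cast at h4
  simp only [hatSpline, hm]
  push_cast
  rw [show (k : ℝ) + 1 - (l + 1) = k - l by ring, show (k : ℝ) + 1 - (l + 2) = k - l - 1 by ring,
    show (k : ℝ) + 1 - (l + 3) = k - l - 2 by ring,
    show (k : ℝ) + 1 + 1 - (l + 1) = k - l + 1 by ring,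
    show (k : ℝ) + 1 + 1 - (l + 2) = k - l by ring,
    show (k : ℝ) + 1 + 1 - (l + 3) = k - l - 1 by ring,
    show (k : ℝ) + 2 + 1 - (l + 1) = k - l + 2 by ring,
    show (k : ℝ) + 2 + 1 - (l + 2) = k - l + 1 by ring,
    show (k : ℝ) + 2 + 1 - (l + 3) = k - l by ring]
  have h6 : hatGramMatrix n k l = 1 / (6 * n) *
      (if ((k : ℤ) - l) = 0 then 4 else if ((k : ℤ) - l) = 1 ∨ ((k : ℤ) - l) = -1 then 1 else 0) := by
    simp only [hatGramMatrix, Matrix.of_apply, Fin.ext_iff]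
    split_ifs <;> first | omega | (field_simp; norm_num) | simp
  rw [h6, ← h4]
  field_simp
  ring

/-! ### Natural cubic splines -/

/-- The piecewise linear function with the values `γ` at the interior design points: the second
derivative of a natural cubic spline. -/
def splineSecond (n : ℕ) (γ : Fin (n - 2) → ℝ) (u : ℝ) : ℝ := ∑ k, γ k * hat n k u

lemma continuous_splineSecond (n : ℕ) (γ : Fin (n - 2) → ℝ) : Continuous (splineSecond n γ) := by
  unfold splineSecond
  have := continuous_hat n
  fun_prop

lemma HasL2SecondDeriv.integral_splineSecond_mul {g g2 : ℝ → ℝ} (h : HasL2SecondDeriv g g2) (n : ℕ)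
    (γ : Fin (n - 2) → ℝ) : ∫ u in (0 : ℝ)..1, splineSecond n γ u * g2 u =
      ((differenceMatrix n)ᵀ *ᵥ fun i => g (designPoint n i)) ⬝ᵥ γ := by
  simp only [splineSecond, Finset.sum_mul, dotProduct]
  rw [intervalIntegral.integral_finsetSum]
  · refine Finset.sum_congr rfl fun k _ => ?_
    rw [h.differences_eq n k, mul_comm, ← intervalIntegral.integral_const_mul]
    simp only [mul_assoc]
  · intro k _
    exact h.intervalIntegrable.continuousOn_mul
      (((continuous_hat n k).const_mul (γ k)).continuousOn)

lemma exists_hasL2SecondDeriv_of_continuous {s : ℝ → ℝ} (hs : Continuous s) :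
    ∃ g, HasL2SecondDeriv g s :=
  ⟨fun t => ∫ x in (0 : ℝ)..t, ∫ u in (0 : ℝ)..x, s u,
    hasL2SecondDeriv_of_hasDerivAt
      (fun t => (intervalIntegral.continuous_primitive
        (fun a b => hs.intervalIntegrable a b) 0).integral_hasStrictDerivAt 0 t |>.hasDerivAt)
      (fun t => (hs.integral_hasStrictDerivAt 0 t).hasDerivAt) hs⟩

lemma HasL2SecondDeriv.differences_eq_mulVec {g : ℝ → ℝ} {n : ℕ} {γ : Fin (n - 2) → ℝ}
    (h : HasL2SecondDeriv g (splineSecond n γ)) :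
    ((differenceMatrix n)ᵀ *ᵥ fun i => g (designPoint n i)) = hatGramMatrix n *ᵥ γ := by
  ext k
  rw [h.differences_eq n k]
  simp only [splineSecond, Finset.mul_sum, Matrix.mulVec, dotProduct]
  rw [intervalIntegral.integral_finsetSum]
  · refine Finset.sum_congr rfl fun l _ => ?_
    rw [← integral_hat_mul_hat, mul_comm, ← intervalIntegral.integral_const_mul]
    congr 1
    ext u
    ring
  · intro l _
    exact ((continuous_hat n k).mul ((continuous_hat n l).const_mul (γ l))).intervalIntegrable _ _

lemma integral_splineSecond_sq (n : ℕ) (γ : Fin (n - 2) → ℝ) :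
    ∫ u in (0 : ℝ)..1, splineSecond n γ u ^ 2 = γ ⬝ᵥ hatGramMatrix n *ᵥ γ := by
  obtain ⟨g, hg⟩ := exists_hasL2SecondDeriv_of_continuous (continuous_splineSecond n γ)
  simp only [pow_two]
  rw [hg.integral_splineSecond_mul, hg.differences_eq_mulVec, dotProduct_comm]

/-- The natural cubic spline through the values of `g` has the least roughness: its second
derivative is the orthogonal projection of `g''` onto the span of the hat functions. -/
lemma HasL2SecondDeriv.roughness_le {g g2 : ℝ → ℝ} (h : HasL2SecondDeriv g g2) (n : ℕ) :
    roughness n (fun i => g (designPoint n i)) ≤ ∫ u in (0 : ℝ)..1, g2 u ^ 2 := by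
  set v : Fin n → ℝ := fun i => g (designPoint n i) with hv
  set γ := knotSecondDeriv n v with hγ
  have i1 := h.intervalIntegrable_sq
  have i2 : IntervalIntegrable (fun u => splineSecond n γ u * g2 u) volume 0 1 :=
    h.intervalIntegrable.continuousOn_mul (continuous_splineSecond n γ).continuousOn
  have i3 : IntervalIntegrable (fun u => splineSecond n γ u ^ 2) volume 0 1 :=
    ((continuous_splineSecond n γ).pow 2).intervalIntegrable _ _
  have e : ∫ u in (0 : ℝ)..1, (g2 u - splineSecond n γ u) ^ 2 =
      (∫ u in (0 : ℝ)..1, g2 u ^ 2) - roughness n v := by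
    have : ∀ u, (g2 u - splineSecond n γ u) ^ 2 =
        g2 u ^ 2 - 2 * (splineSecond n γ u * g2 u) + splineSecond n γ u ^ 2 := fun u => by ring
    simp only [this]
    rw [intervalIntegral.integral_add (i1.sub (i2.const_mul 2)) i3,
      intervalIntegral.integral_sub i1 (i2.const_mul 2), intervalIntegral.integral_const_mul,
      h.integral_splineSecond_mul, integral_splineSecond_sq, ← hv, hγ, ← roughness_eq_dotProduct,
      ← roughness_eq_quadratic]
    ring
  have : 0 ≤ ∫ u in (0 : ℝ)..1, (g2 u - splineSecond n γ u) ^ 2 :=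
    intervalIntegral.integral_nonneg zero_le_one fun u _ => sq_nonneg _
  linarith

/-- Natural cubic spline interpolation. -/
lemma exists_interpolating_spline (n : ℕ) (v : Fin n → ℝ) :
    ∃ g g2 : ℝ → ℝ, HasL2SecondDeriv g g2 ∧ (∀ i, g (designPoint n i) = v i) ∧
      ∫ u in (0 : ℝ)..1, g2 u ^ 2 = roughness n v := by
  obtain ⟨g, hg⟩ := exists_hasL2SecondDeriv_of_continuous
    (continuous_splineSecond n (knotSecondDeriv n v))
  have h0 : (differenceMatrix n)ᵀ *ᵥ (v - fun i => g (designPoint n i)) = 0 := by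
    rw [Matrix.mulVec_sub, hg.differences_eq_mulVec, hatGramMatrix_mulVec_knotSecondDeriv, sub_self]
  obtain ⟨a, b, hab⟩ := exists_affine_of_differences_eq_zero h0
  refine ⟨_, _, hg.add_affine a b, fun i => ?_, ?_⟩
  · rw [← hab i, Pi.sub_apply]
    ring
  · rw [integral_splineSecond_sq, ← roughness_eq_quadratic]

lemma criterion_eq (n : ℕ) (lam : ℝ) (y : Fin n → ℝ) (g g2 : ℝ → ℝ) :
    criterion n lam y g g2 = lam * ((y - fun i => g (designPoint n i)) ⬝ᵥ
      (y - fun i => g (designPoint n i))) + ∫ u in (0 : ℝ)..1, g2 u ^ 2 := by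
  simp only [criterion, dotProduct, Pi.sub_apply, Finset.mul_sum, pow_two]

lemma HasL2SecondDeriv.penalizedSum_le_criterion {g g2 : ℝ → ℝ} (h : HasL2SecondDeriv g g2)
    (n : ℕ) (lam : ℝ) (y : Fin n → ℝ) :
    penalizedSum n lam y (fun i => g (designPoint n i)) ≤ criterion n lam y g g2 := by
  rw [criterion_eq, penalizedSum]
  linarith [h.roughness_le n]

lemma exists_criterion_eq_penalizedSum (n : ℕ) (lam : ℝ) (y : Fin n → ℝ) :
    ∃ g g2 : ℝ → ℝ, HasL2SecondDeriv g g2 ∧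
      criterion n lam y g g2 = penalizedSum n lam y (splineFit n lam y) := by
  obtain ⟨g, g2, hg, hv, hr⟩ := exists_interpolating_spline n (splineFit n lam y)
  refine ⟨g, g2, hg, ?_⟩
  rw [criterion_eq, penalizedSum, hr, funext hv]

lemma exists_isSmoothingSpline (n : ℕ) (y : Fin n → ℝ) {lam : ℝ} (hl : 0 < lam) :
    ∃ g g2 : ℝ → ℝ, IsSmoothingSpline n lam y g g2 := by
  obtain ⟨g, g2, hg, hv⟩ := exists_criterion_eq_penalizedSum n lam y
  refine ⟨g, g2, hg, fun h h2 hh => ?_⟩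
  rw [hv]
  exact (penalizedSum_splineFit_le n hl y _).trans (hh.penalizedSum_le_criterion n lam y)

lemma IsSmoothingSpline.eq_splineFit {n : ℕ} {y : Fin n → ℝ} {lam : ℝ} (hl : 0 < lam)
    {g g2 : ℝ → ℝ} (hg : IsSmoothingSpline n lam y g g2) :
    (∀ i, g (designPoint n i) = splineFit n lam y i) ∧
      ∫ u in (0 : ℝ)..1, g2 u ^ 2 = roughness n (splineFit n lam y) := by
  obtain ⟨s, s2, hs, hv⟩ := exists_criterion_eq_penalizedSum n lam y
  have h1 := hg.2 s s2 hs
  rw [hv] at h1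
  have h2 := hg.1.penalizedSum_le_criterion n lam y
  have h3 := eq_splineFit_of_penalizedSum_le hl (h2.trans h1)
  refine ⟨fun i => congrFun h3 i, ?_⟩
  rw [criterion_eq, h3, penalizedSum] at h1
  have h4 := hg.1.roughness_le n
  rw [h3] at h4
  linarith

/-! ### The roughness of the fit to noise -/

lemma sum_mul_second_difference (X : ℕ → ℝ) (N : ℕ) :
    ∑ i ∈ Finset.range N, X (i + 1) * (X i - 2 * X (i + 1) + X (i + 2))
      + ∑ i ∈ Finset.range N, (X (i + 1) - X i) ^ 2
      = X N * (X (N + 1) - X N) - X 0 * (X 1 - X 0) := by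
  induction N with
  | zero => simp
  | succ N ih =>
    rw [Finset.sum_range_succ, Finset.sum_range_succ]
    linear_combination ih

/-- A discrete Gagliardo–Nirenberg inequality `‖X‖_∞² ≤ 2 ‖X‖^{3/2} ‖X''‖^{1/2}` for a sequence
that vanishes outside of a bounded interval. -/
lemma pow_eight_le_of_zero_ends {X : ℕ → ℝ} {N : ℕ} (h0 : X 0 = 0) (hN : X N = 0) {j : ℕ}
    (hj : j ≤ N) :
    X j ^ 8 ≤ 16 * (∑ i ∈ Finset.range N, X i ^ 2) ^ 3 *
      ∑ i ∈ Finset.range N, (X i - 2 * X (i + 1) + X (i + 2)) ^ 2 := by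
  set S := ∑ i ∈ Finset.range N, X i ^ 2 with hS
  set D := ∑ i ∈ Finset.range N, (X i - 2 * X (i + 1) + X (i + 2)) ^ 2 with hD
  set T := ∑ i ∈ Finset.range N, (X (i + 1) - X i) ^ 2 with hT
  have hS0 : 0 ≤ S := Finset.sum_nonneg fun _ _ => sq_nonneg _
  have hT0 : 0 ≤ T := Finset.sum_nonneg fun _ _ => sq_nonneg _
  have hS' : ∑ i ∈ Finset.range N, X (i + 1) ^ 2 = S := by
    have := (Finset.sum_range_succ (fun i => X i ^ 2) N).symm.trans
      (Finset.sum_range_succ' (fun i => X i ^ 2) N)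
    rw [h0, hN] at this
    linarith
  have h1 : T ^ 2 ≤ S * D := by
    have e := sum_mul_second_difference X N
    rw [h0, hN] at e
    have e' : T = -∑ i ∈ Finset.range N, X (i + 1) * (X i - 2 * X (i + 1) + X (i + 2)) := by
      linarith
    rw [e', neg_sq, ← hS']
    exact Finset.sum_mul_sq_le_sq_mul_sq _ _ _
  have h2 : X j ^ 4 ≤ 4 * S * T := by
    have e : X j ^ 2 = ∑ i ∈ Finset.range j, (X (i + 1) - X i) * (X (i + 1) + X i) := by
      have := Finset.sum_range_sub (fun i => X i ^ 2) j
      rw [h0] at this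
      rw [show X j ^ 2 = X j ^ 2 - 0 ^ 2 by ring, ← this]
      exact Finset.sum_congr rfl fun i _ => by ring
    have hsub : Finset.range j ⊆ Finset.range N := Finset.range_subset_range.2 hj
    have h3 : ∑ i ∈ Finset.range j, (X (i + 1) - X i) ^ 2 ≤ T :=
      Finset.sum_le_sum_of_subset_of_nonneg hsub fun _ _ _ => sq_nonneg _
    have h4 : ∑ i ∈ Finset.range j, (X (i + 1) + X i) ^ 2 ≤ 4 * S := by
      calc _ ≤ ∑ i ∈ Finset.range N, (X (i + 1) + X i) ^ 2 :=
            Finset.sum_le_sum_of_subset_of_nonneg hsub fun _ _ _ => sq_nonneg _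
        _ ≤ ∑ i ∈ Finset.range N, (2 * X (i + 1) ^ 2 + 2 * X i ^ 2) :=
            Finset.sum_le_sum fun i _ => by nlinarith [sq_nonneg (X (i + 1) - X i)]
        _ = 4 * S := by
            rw [Finset.sum_add_distrib, ← Finset.mul_sum, ← Finset.mul_sum, hS']
            ring
    calc X j ^ 4 = (X j ^ 2) ^ 2 := by ring
      _ ≤ _ := by rw [e]; exact Finset.sum_mul_sq_le_sq_mul_sq _ _ _
      _ ≤ T * (4 * S) := mul_le_mul h3 h4 (Finset.sum_nonneg fun _ _ => sq_nonneg _) hT0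
      _ = 4 * S * T := by ring
  calc X j ^ 8 = (X j ^ 4) ^ 2 := by ring
    _ ≤ (4 * S * T) ^ 2 := by gcongr
    _ = 16 * S ^ 2 * T ^ 2 := by ring
    _ ≤ 16 * S ^ 2 * (S * D) := by gcongr
    _ = _ := by ring

/-- The matrix of the normal equations for the second derivatives at the knots of the fit. -/
def knotMatrix (n : ℕ) (lam : ℝ) : Matrix (Fin (n - 2)) (Fin (n - 2)) ℝ :=
  lam • hatGramMatrix n + (differenceMatrix n)ᵀ * differenceMatrix n

lemma dotProduct_knotMatrix_mulVec (n : ℕ) (lam : ℝ) (x : Fin (n - 2) → ℝ) :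
    x ⬝ᵥ knotMatrix n lam *ᵥ x = lam * (x ⬝ᵥ hatGramMatrix n *ᵥ x) +
      (differenceMatrix n *ᵥ x) ⬝ᵥ (differenceMatrix n *ᵥ x) := by
  rw [knotMatrix, Matrix.add_mulVec, dotProduct_add, Matrix.smul_mulVec, dotProduct_smul,
    smul_eq_mul, ← Matrix.mulVec_mulVec, dotProduct_transpose_mulVec (differenceMatrix n)ᵀ,
    Matrix.transpose_transpose]

lemma knotMatrix_posDef (n : ℕ) {lam : ℝ} (hl : 0 < lam) : (knotMatrix n lam).PosDef := by
  have h := Matrix.posSemidef_conjTranspose_mul_self (differenceMatrix n)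
  rw [Matrix.conjTranspose_eq_transpose_of_trivial] at h
  exact ((hatGramMatrix_posDef n).smul hl).add_posSemidef h

lemma knotMatrix_transpose (n : ℕ) (lam : ℝ) : (knotMatrix n lam)ᵀ = knotMatrix n lam := by
  simp [knotMatrix, Matrix.transpose_add, Matrix.transpose_smul, hatGramMatrix_transpose,
    Matrix.transpose_mul]

lemma dotProduct_self_eq_sum_zeroExtend {n : ℕ} (hn : 2 ≤ n) (x : Fin (n - 2) → ℝ) :
    x ⬝ᵥ x = ∑ i ∈ Finset.range n, zeroExtend n x i ^ 2 := by
  obtain ⟨m, rfl⟩ := Nat.exists_eq_add_of_le' hn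
  rw [Finset.sum_range_succ', Finset.sum_range_succ', zeroExtend_of_lt x (by omega),
    zeroExtend_of_lt x (by omega), dotProduct]
  simp only [ne_eq, OfNat.ofNat_ne_zero, not_false_eq_true, zero_pow, add_zero]
  rw [← Fin.sum_univ_eq_sum_range (fun i => zeroExtend (m + 2) x (i + 1 + 1) ^ 2) m]
  refine Finset.sum_congr rfl fun k _ => ?_
  rw [← zeroExtend_add_two x k, pow_two]

lemma differenceMatrix_mulVec_sq (n : ℕ) (x : Fin (n - 2) → ℝ) :
    (differenceMatrix n *ᵥ x) ⬝ᵥ (differenceMatrix n *ᵥ x) = (n : ℝ) ^ 2 *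
      ∑ i ∈ Finset.range n, (zeroExtend n x i - 2 * zeroExtend n x (i + 1)
        + zeroExtend n x (i + 2)) ^ 2 := by
  rw [← Fin.sum_univ_eq_sum_range (fun i => (zeroExtend n x i - 2 * zeroExtend n x (i + 1)
        + zeroExtend n x (i + 2)) ^ 2) n, Finset.mul_sum, dotProduct]
  refine Finset.sum_congr rfl fun i _ => ?_
  rw [differenceMatrix_mulVec]
  ring

/-- The discrete Gagliardo–Nirenberg inequality in terms of the quadratic form of `knotMatrix`. -/
lemma sq_le_mul_knotMatrix (n : ℕ) {lam : ℝ} (hl : 0 < lam) (x : Fin (n - 2) → ℝ)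
    (k : Fin (n - 2)) :
    x k ^ 2 ≤ 5 * (n : ℝ) ^ (1 / 4 : ℝ) * lam ^ (-(3 / 4) : ℝ) * (x ⬝ᵥ knotMatrix n lam *ᵥ x) := by
  have hk := k.2
  have hn : 2 ≤ n := by omega
  have hn0 : (0 : ℝ) < n := by exact_mod_cast (by omega : 0 < n)
  set E := x ⬝ᵥ knotMatrix n lam *ᵥ x with hE
  set S := x ⬝ᵥ x with hS
  set D := (differenceMatrix n *ᵥ x) ⬝ᵥ (differenceMatrix n *ᵥ x) with hD
  have hS0 : 0 ≤ S := zero_le_dotProduct_self x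
  have hD0 : 0 ≤ D := zero_le_dotProduct_self _
  have hle : lam * (1 / (3 * n) * S) + D ≤ E := by
    rw [hE, dotProduct_knotMatrix_mulVec]
    gcongr
    exact le_hatGramMatrix_quadratic n x
  have hSE : S ≤ 3 * n / lam * E := by
    have : lam * (1 / (3 * n) * S) ≤ E := by linarith
    calc S = 3 * n / lam * (lam * (1 / (3 * n) * S)) := by field_simp
      _ ≤ _ := by gcongr
  have hDE : D ≤ E := by
    have : 0 ≤ lam * (1 / (3 * n) * S) := by positivity
    linarith
  have hE0 : 0 ≤ E := hD0.trans hDE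
  have h8 := pow_eight_le_of_zero_ends (X := zeroExtend n x) (N := n)
    (zeroExtend_of_lt x (by omega)) (zeroExtend_of_le x le_rfl) (j := k + 2) (by omega)
  rw [zeroExtend_add_two, ← dotProduct_self_eq_sum_zeroExtend hn, ← hS] at h8
  have hD' := differenceMatrix_mulVec_sq n x
  rw [← hD] at hD'
  set D' := ∑ i ∈ Finset.range n, (zeroExtend n x i - 2 * zeroExtend n x (i + 1)
        + zeroExtend n x (i + 2)) ^ 2
  have hD'' : D' = D / n ^ 2 := by rw [hD']; field_simp
  rw [hD''] at h8
  set κ := 5 * (n : ℝ) ^ (1 / 4 : ℝ) * lam ^ (-(3 / 4) : ℝ) with hκ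
  have hκ0 : 0 ≤ κ := by positivity
  have hκ4 : κ ^ 4 = 625 * n / lam ^ 3 := by
    rw [hκ, mul_pow, mul_pow, ← Real.rpow_natCast, ← Real.rpow_natCast, ← Real.rpow_natCast,
      ← Real.rpow_mul hn0.le, ← Real.rpow_mul hl.le]
    rw [show (1 / 4 : ℝ) * ((4 : ℕ) : ℝ) = 1 by norm_num,
      show (-(3 / 4) : ℝ) * ((4 : ℕ) : ℝ) = -((3 : ℕ) : ℝ) by norm_num, Real.rpow_one,
      Real.rpow_neg hl.le, Real.rpow_natCast, Real.rpow_natCast]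
    norm_num
    ring
  have hfin : (x k ^ 2) ^ 4 ≤ (κ * E) ^ 4 := by
    calc (x k ^ 2) ^ 4 = x k ^ 8 := by ring
      _ ≤ 16 * S ^ 3 * (D / n ^ 2) := h8
      _ ≤ 16 * (3 * n / lam * E) ^ 3 * (E / n ^ 2) := by gcongr
      _ = 432 * n / lam ^ 3 * E ^ 4 := by
          field_simp
          ring
      _ ≤ 625 * n / lam ^ 3 * E ^ 4 := by
          gcongr
          norm_num
      _ = (κ * E) ^ 4 := by rw [mul_pow, hκ4]
  exact le_of_pow_le_pow_left₀ (by norm_num) (by positivity) hfin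

/-- With `x` the column `k` of the inverse, `x k` equals the quadratic form at `x`. Hence a bound of
`x k ^ 2` by a multiple of the quadratic form is a bound of `x k` itself. -/
lemma knotMatrix_inv_diag_le (n : ℕ) {lam : ℝ} (hl : 0 < lam) (k : Fin (n - 2)) :
    (knotMatrix n lam)⁻¹ k k ≤ 5 * (n : ℝ) ^ (1 / 4 : ℝ) * lam ^ (-(3 / 4) : ℝ) ∧
    ((differenceMatrix n * (knotMatrix n lam)⁻¹) *ᵥ Pi.single k 1) ⬝ᵥ
      ((differenceMatrix n * (knotMatrix n lam)⁻¹) *ᵥ Pi.single k 1) ≤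
        (knotMatrix n lam)⁻¹ k k := by
  set x := (knotMatrix n lam)⁻¹ *ᵥ Pi.single k 1 with hx
  have hu := (Matrix.isUnit_iff_isUnit_det _).1 (knotMatrix_posDef n hl).isUnit
  have hxk : x k = (knotMatrix n lam)⁻¹ k k := by
    rw [hx, Matrix.mulVec_single_one]
    rfl
  have hG : knotMatrix n lam *ᵥ x = Pi.single k 1 := by
    rw [hx, Matrix.mulVec_mulVec, Matrix.mul_nonsing_inv _ hu, Matrix.one_mulVec]
  have hE : x ⬝ᵥ knotMatrix n lam *ᵥ x = x k := by
    rw [hG, dotProduct_single, mul_one]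
  have hQ := dotProduct_knotMatrix_mulVec n lam x
  have hR : 0 ≤ x ⬝ᵥ hatGramMatrix n *ᵥ x :=
    by simpa using (hatGramMatrix_posDef n).posSemidef.dotProduct_mulVec_nonneg x
  constructor
  · have h := sq_le_mul_knotMatrix n hl x k
    rw [hE] at h
    rw [← hxk]
    rcases le_or_gt (x k) 0 with h0 | h0
    · exact h0.trans (by positivity)
    · rw [pow_two] at h
      exact le_of_mul_le_mul_right h h0
  · rw [← hxk, ← hE, hQ, ← Matrix.mulVec_mulVec, ← hx]
    linarith [mul_nonneg hl.le hR]

lemma knotSecondDeriv_splineFit (n : ℕ) {lam : ℝ} (hl : 0 < lam) (y : Fin n → ℝ) :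
    knotSecondDeriv n (splineFit n lam y) =
      lam • (((knotMatrix n lam)⁻¹ * (differenceMatrix n)ᵀ) *ᵥ y) := by
  set γ := knotSecondDeriv n (splineFit n lam y) with hγ
  have hu := (Matrix.isUnit_iff_isUnit_det _).1 (knotMatrix_posDef n hl).isUnit
  have h1 := roughnessMatrix_mulVec_splineFit n hl y
  rw [roughnessMatrix_mulVec_eq, ← hγ] at h1
  have h2 := hatGramMatrix_mulVec_knotSecondDeriv n (splineFit n lam y)
  rw [← hγ] at h2
  have h3 : knotMatrix n lam *ᵥ γ = lam • ((differenceMatrix n)ᵀ *ᵥ y) := by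
    rw [knotMatrix, Matrix.add_mulVec, Matrix.smul_mulVec, h2, ← Matrix.mulVec_mulVec, h1,
      Matrix.mulVec_smul, Matrix.mulVec_sub, smul_sub]
    abel
  rw [← Matrix.mulVec_mulVec, ← Matrix.mulVec_smul, ← h3, Matrix.mulVec_mulVec,
    Matrix.nonsing_inv_mul _ hu, Matrix.one_mulVec]

lemma sum_mulVec_single_sq {ι κ : Type*} [Fintype ι] [Fintype κ] [DecidableEq ι] [DecidableEq κ]
    (B : Matrix κ ι ℝ) : ∑ i, (B *ᵥ Pi.single i 1) ⬝ᵥ (B *ᵥ Pi.single i 1) =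
      ∑ k, (Bᵀ *ᵥ Pi.single k 1) ⬝ᵥ (Bᵀ *ᵥ Pi.single k 1) := by
  simp only [Matrix.mulVec_single_one, dotProduct, Matrix.col_apply, Matrix.transpose_apply]
  exact Finset.sum_comm

/-- The sum of the roughnesses of the fits to the unit vectors, which is the trace that governs the
expected roughness of the fit to white noise. -/
lemma sum_roughness_splineFit_single_le (n : ℕ) {lam : ℝ} (hl : 0 < lam) :
    ∑ i : Fin n, roughness n (splineFit n lam (Pi.single i 1)) ≤
      5 * (n : ℝ) ^ (1 / 4 : ℝ) * lam ^ (5 / 4 : ℝ) := by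
  rcases Nat.eq_zero_or_pos n with rfl | hn
  · simp
  have hn0 : (0 : ℝ) < n := by exact_mod_cast hn
  set κ := 5 * (n : ℝ) ^ (1 / 4 : ℝ) * lam ^ (-(3 / 4) : ℝ) with hκ
  have hκ0 : 0 ≤ κ := by positivity
  set B := (knotMatrix n lam)⁻¹ * (differenceMatrix n)ᵀ with hB
  have hBT : Bᵀ = differenceMatrix n * (knotMatrix n lam)⁻¹ := by
    rw [hB, Matrix.transpose_mul, Matrix.transpose_transpose, Matrix.transpose_nonsing_inv,
      knotMatrix_transpose]
  have h1 : ∀ i : Fin n, roughness n (splineFit n lam (Pi.single i 1)) ≤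
      lam ^ 2 / n * ((B *ᵥ Pi.single i 1) ⬝ᵥ (B *ᵥ Pi.single i 1)) := by
    intro i
    rw [roughness_eq_quadratic]
    refine (hatGramMatrix_quadratic_le n _).trans (le_of_eq ?_)
    rw [knotSecondDeriv_splineFit n hl, ← hB, smul_dotProduct, dotProduct_smul]
    simp only [smul_eq_mul]
    ring
  calc _ ≤ ∑ i : Fin n, lam ^ 2 / n * ((B *ᵥ Pi.single i 1) ⬝ᵥ (B *ᵥ Pi.single i 1)) :=
        Finset.sum_le_sum fun i _ => h1 i
    _ = lam ^ 2 / n * ∑ k, (Bᵀ *ᵥ Pi.single k 1) ⬝ᵥ (Bᵀ *ᵥ Pi.single k 1) := by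
        rw [← Finset.mul_sum, sum_mulVec_single_sq]
    _ ≤ lam ^ 2 / n * ∑ k : Fin (n - 2), κ := by
        gcongr with k _
        rw [hBT]
        exact (knotMatrix_inv_diag_le n hl k).2.trans (knotMatrix_inv_diag_le n hl k).1
    _ ≤ lam ^ 2 / n * (n * κ) := by
        rw [Finset.sum_const, nsmul_eq_mul, Finset.card_univ, Fintype.card_fin]
        gcongr
        omega
    _ = _ := by
        have : lam ^ (5 / 4 : ℝ) = lam ^ 2 * lam ^ (-(3 / 4) : ℝ) := by
          rw [← Real.rpow_natCast, ← Real.rpow_add hl]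
          norm_num
        rw [this, hκ]
        field_simp

/-! ### Linear and quadratic forms in the noise -/

/-- The noise at the design points. -/
def noise {Ω : Type*} (Z : ℝ → Ω → ℝ) (n : ℕ) (ω : Ω) : Fin n → ℝ :=
  fun i => Z (designPoint n i) ω

lemma designPoint_injective (n : ℕ) : Function.Injective (designPoint n) := by
  intro i j h
  have hn : (n : ℝ) ≠ 0 := by exact_mod_cast i.pos.ne'
  simp only [designPoint, div_left_inj' hn, add_left_inj, Nat.cast_inj] at h
  exact Fin.ext h

lemma observations_eq {Ω : Type*} (f : ℝ → ℝ) (σ : ℝ) (Z : ℝ → Ω → ℝ) (n : ℕ) (ω : Ω) :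
    observations f σ Z n ω = (fun i => f (designPoint n i)) + σ • noise Z n ω := rfl

section Noise

variable {Ω : Type*} [MeasurableSpace Ω] {P : Measure Ω} {Z : ℝ → Ω → ℝ}

lemma IsWhiteNoise.hasLaw_noise (hZ : IsWhiteNoise Z P) (n : ℕ) (i : Fin n) :
    HasLaw (fun ω => noise Z n ω i) (gaussianReal 0 1) P :=
  hZ.gaussian _ (designPoint_mem_Icc i)

lemma IsWhiteNoise.iIndepFun_noise (hZ : IsWhiteNoise Z P) (n : ℕ) :
    iIndepFun (fun (i : Fin n) ω => noise Z n ω i) P :=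
  hZ.indep.precomp (g := fun i : Fin n => (⟨designPoint n i, designPoint_mem_Icc i⟩ :
    Set.Icc (0 : ℝ) 1)) fun _ _ h => designPoint_injective n (Subtype.ext_iff.1 h)

lemma IsWhiteNoise.hasSubgaussianMGF_noise (hZ : IsWhiteNoise Z P) (n : ℕ) (i : Fin n) :
    HasSubgaussianMGF (fun ω => noise Z n ω i) 1 P := by
  have h := hZ.hasLaw_noise n i
  refine ⟨fun t => ?_, fun t => ?_⟩
  · have hi := integrable_exp_mul_gaussianReal (μ := 0) (v := 1) t
    rw [← h.map_eq] at hi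
    exact hi.comp_aemeasurable h.aemeasurable
  · rw [mgf_gaussianReal h.map_eq]
    simp

lemma IsWhiteNoise.memLp_noise (hZ : IsWhiteNoise Z P) (n : ℕ) (i : Fin n) :
    MemLp (fun ω => noise Z n ω i) 2 P :=
  (hZ.hasSubgaussianMGF_noise n i).memLp 2

lemma IsWhiteNoise.integral_noise (hZ : IsWhiteNoise Z P) (n : ℕ) (i : Fin n) :
    ∫ ω, noise Z n ω i ∂P = 0 := by
  rw [(hZ.hasLaw_noise n i).integral_eq, integral_id_gaussianReal]

lemma IsWhiteNoise.integrable_noise_mul (hZ : IsWhiteNoise Z P) (n : ℕ) (i j : Fin n) :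
    Integrable (fun ω => noise Z n ω i * noise Z n ω j) P :=
  (hZ.memLp_noise n i).integrable_mul (hZ.memLp_noise n j)

lemma IsWhiteNoise.integral_noise_mul [IsProbabilityMeasure P] (hZ : IsWhiteNoise Z P) (n : ℕ)
    (i j : Fin n) :
    ∫ ω, noise Z n ω i * noise Z n ω j ∂P = if i = j then 1 else 0 := by
  split_ifs with h
  · subst h
    have hv := (hZ.hasLaw_noise n i).variance_eq
    rw [variance_id_gaussianReal, variance_of_integral_eq_zero
      (hZ.memLp_noise n i).aemeasurable (hZ.integral_noise n i)] at hv
    simpa [pow_two] using hv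
  · rw [((hZ.iIndepFun_noise n).indepFun h).integral_fun_mul_eq_mul_integral
      (hZ.memLp_noise n i).aestronglyMeasurable (hZ.memLp_noise n j).aestronglyMeasurable,
      hZ.integral_noise, zero_mul]

/-- Gaussian tail bound for a linear form in the noise. -/
lemma IsWhiteNoise.measure_abs_dotProduct_noise_le (hZ : IsWhiteNoise Z P) {n : ℕ}
    {a : Fin n → ℝ} (ha : a ⬝ᵥ a ≤ 1) {ε : ℝ} (hε : 0 ≤ ε) :
    P {ω | ε ≤ |a ⬝ᵥ noise Z n ω|} ≤ ENNReal.ofReal (2 * Real.exp (-ε ^ 2 / 2)) := by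
  have : IsProbabilityMeasure P := hZ.indep.isProbabilityMeasure
  have h1 : ∀ i ∈ (Finset.univ : Finset (Fin n)), HasSubgaussianMGF
      (fun ω => a i * noise Z n ω i) (.mk (a i ^ 2) (sq_nonneg _) * 1) P := fun i _ =>
    (hZ.hasSubgaussianMGF_noise n i).const_mul (a i)
  have h2 := HasSubgaussianMGF.sum_of_iIndepFun
    ((hZ.iIndepFun_noise n).comp (fun i x => a i * x) fun i => measurable_const_mul (a i)) h1
  have hc : ((∑ i, .mk (a i ^ 2) (sq_nonneg _) * 1 : NNReal) : ℝ) ≤ 1 := by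
    rw [NNReal.coe_sum]
    refine (Finset.sum_congr rfl fun i _ => ?_).trans_le ha
    rw [NNReal.coe_mul, NNReal.coe_one, mul_one, ← pow_two]
    rfl
  have h3 : HasSubgaussianMGF (fun ω => a ⬝ᵥ noise Z n ω) 1 P := by
    refine ⟨h2.integrable_exp_mul, fun t => (h2.mgf_le t).trans ?_⟩
    gcongr
    exact_mod_cast hc
  have h4 := h3.measure_ge_le hε
  have h5 := h3.neg.measure_ge_le hε
  rw [NNReal.coe_one, mul_one] at h4 h5
  have hsub : {ω | ε ≤ |a ⬝ᵥ noise Z n ω|} ⊆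
      {ω | ε ≤ a ⬝ᵥ noise Z n ω} ∪ {ω | ε ≤ (-fun ω => a ⬝ᵥ noise Z n ω) ω} := by
    intro ω (hω : ε ≤ |a ⬝ᵥ noise Z n ω|)
    exact le_abs.1 hω
  calc _ ≤ P {ω | ε ≤ a ⬝ᵥ noise Z n ω} + P {ω | ε ≤ (-fun ω => a ⬝ᵥ noise Z n ω) ω} :=
        (measure_mono hsub).trans (measure_union_le _ _)
    _ ≤ ENNReal.ofReal (Real.exp (-ε ^ 2 / 2)) + ENNReal.ofReal (Real.exp (-ε ^ 2 / 2)) := by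
        rw [← ofReal_measureReal, ← ofReal_measureReal]
        gcongr
    _ = _ := by
        rw [← ENNReal.ofReal_add (by positivity) (by positivity), two_mul]

lemma splineFit_eq_sum (n : ℕ) (lam : ℝ) (z : Fin n → ℝ) :
    splineFit n lam z = ∑ i, z i • splineFit n lam (Pi.single i 1) := by
  have hz : z = ∑ i, z i • (Pi.single i 1 : Fin n → ℝ) := by
    ext j
    simp [Finset.sum_apply, Pi.single_apply]
  conv_lhs => rw [hz]
  rw [splineFit, Matrix.mulVec_sum, Finset.smul_sum]
  refine Finset.sum_congr rfl fun i _ => ?_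
  rw [Matrix.mulVec_smul, splineFit, smul_comm]

/-- The roughness of the fit to signal plus noise, expanded in the noise variables. -/
lemma roughness_splineFit_add (n : ℕ) (lam σ : ℝ) (x z : Fin n → ℝ) :
    roughness n (splineFit n lam (x + σ • z)) = roughness n (splineFit n lam x)
      + ∑ i, z i * (2 * σ * (splineFit n lam (Pi.single i 1) ⬝ᵥ
          roughnessMatrix n *ᵥ splineFit n lam x))
      + ∑ i, ∑ j, z i * z j * (σ ^ 2 * (splineFit n lam (Pi.single i 1) ⬝ᵥ
          roughnessMatrix n *ᵥ splineFit n lam (Pi.single j 1))) := by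
  rw [splineFit_add, splineFit_smul, roughness_add, splineFit_eq_sum n lam z]
  congr 1
  · congr 1
    rw [smul_dotProduct, sum_dotProduct, smul_eq_mul, Finset.mul_sum, Finset.mul_sum]
    refine Finset.sum_congr rfl fun i _ => ?_
    rw [smul_dotProduct, smul_eq_mul]
    ring
  · rw [roughness, Matrix.mulVec_smul, Matrix.mulVec_sum, smul_dotProduct, dotProduct_smul,
      sum_dotProduct]
    simp only [dotProduct_sum, smul_eq_mul, Finset.mul_sum]
    refine Finset.sum_congr rfl fun i _ => Finset.sum_congr rfl fun j _ => ?_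
    rw [smul_dotProduct, Matrix.mulVec_smul, dotProduct_smul, smul_eq_mul, smul_eq_mul]
    ring

variable [IsProbabilityMeasure P]

lemma IsWhiteNoise.integrable_roughness (hZ : IsWhiteNoise Z P) (n : ℕ) (lam : ℝ) (f : ℝ → ℝ)
    (σ : ℝ) : Integrable (fun ω => roughness n (splineFit n lam (observations f σ Z n ω))) P := by
  simp only [observations_eq, roughness_splineFit_add]
  refine ((integrable_const _).add (integrable_finsetSum _ fun i _ => ?_)).add
    (integrable_finsetSum _ fun i _ => integrable_finsetSum _ fun j _ => ?_)
  · exact ((hZ.memLp_noise n i).integrable one_le_two).mul_const _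
  · exact (hZ.integrable_noise_mul n i j).mul_const _

lemma IsWhiteNoise.integral_quadratic (hZ : IsWhiteNoise Z P) {n : ℕ} (A : ℝ) (c : Fin n → ℝ)
    (d : Fin n → Fin n → ℝ) :
    ∫ ω, (A + ∑ i, noise Z n ω i * c i + ∑ i, ∑ j, noise Z n ω i * noise Z n ω j * d i j) ∂P =
      A + ∑ i, d i i := by
  have i1 : ∀ i : Fin n, Integrable (fun ω => noise Z n ω i * c i) P := fun i =>
    ((hZ.memLp_noise n i).integrable one_le_two).mul_const _
  have i2 : ∀ i j : Fin n, Integrable (fun ω => noise Z n ω i * noise Z n ω j * d i j) P :=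
    fun i j => (hZ.integrable_noise_mul n i j).mul_const _
  have s1 : Integrable (fun ω => ∑ i, noise Z n ω i * c i) P :=
    integrable_finsetSum _ fun i _ => i1 i
  have s2' : ∀ i : Fin n, Integrable (fun ω => ∑ j, noise Z n ω i * noise Z n ω j * d i j) P :=
    fun i => integrable_finsetSum _ fun j _ => i2 i j
  have s2 : Integrable (fun ω => ∑ i, ∑ j, noise Z n ω i * noise Z n ω j * d i j) P :=
    integrable_finsetSum _ fun i _ => s2' i
  have s0 : Integrable (fun _ : Ω => A) P := integrable_const A
  have s01 : Integrable (fun ω => A + ∑ i, noise Z n ω i * c i) P := s0.add s1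
  rw [integral_add s01 s2, integral_add s0 s1, integral_finsetSum _ fun i _ => i1 i,
    integral_finsetSum _ fun i _ => s2' i]
  have e : ∀ i, ∫ ω, ∑ j, noise Z n ω i * noise Z n ω j * d i j ∂P = d i i := by
    intro i
    rw [integral_finsetSum _ fun j _ => i2 i j]
    simp [integral_mul_const, hZ.integral_noise_mul]
  simp [e, integral_mul_const, hZ.integral_noise]

lemma IsWhiteNoise.integral_roughness (hZ : IsWhiteNoise Z P) (n : ℕ) (lam : ℝ) (f : ℝ → ℝ)
    (σ : ℝ) : ∫ ω, roughness n (splineFit n lam (observations f σ Z n ω)) ∂P =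
      roughness n (splineFit n lam fun i => f (designPoint n i))
        + σ ^ 2 * ∑ i : Fin n, roughness n (splineFit n lam (Pi.single i 1)) := by
  simp only [observations_eq, roughness_splineFit_add]
  rw [hZ.integral_quadratic, Finset.mul_sum]
  rfl

lemma IsWhiteNoise.integral_roughness_le (hZ : IsWhiteNoise Z P) {f f2 : ℝ → ℝ}
    (hf : HasL2SecondDeriv f f2) (σ : ℝ) (n : ℕ) {lam : ℝ} (hl : 0 < lam) :
    ∫ ω, roughness n (splineFit n lam (observations f σ Z n ω)) ∂P ≤
      (∫ u in (0 : ℝ)..1, f2 u ^ 2) + 5 * σ ^ 2 * (n : ℝ) ^ (1 / 4 : ℝ) * lam ^ (5 / 4 : ℝ) := by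
  rw [hZ.integral_roughness]
  have h1 := (roughness_splineFit_le n hl _).trans (hf.roughness_le n)
  have h2 := mul_le_mul_of_nonneg_left (sum_roughness_splineFit_single_le n hl) (sq_nonneg σ)
  calc _ ≤ _ := add_le_add h1 h2
    _ = _ := by ring

/-- For weights of at least the order `n ^ (-1/5)` the noise dominates the expected roughness. -/
lemma IsWhiteNoise.integral_roughness_le_of_le (hZ : IsWhiteNoise Z P) {f f2 : ℝ → ℝ}
    (hf : HasL2SecondDeriv f f2) (σ : ℝ) {a : ℝ} (ha : 0 < a) {n : ℕ} (hn : 1 ≤ n) {lam : ℝ}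
    (hl : a * (n : ℝ) ^ (-(1 / 5) : ℝ) ≤ lam) :
    ∫ ω, roughness n (splineFit n lam (observations f σ Z n ω)) ∂P ≤
      ((∫ u in (0 : ℝ)..1, f2 u ^ 2) * a ^ (-(5 / 4) : ℝ) + 5 * σ ^ 2)
        * (n : ℝ) ^ (1 / 4 : ℝ) * lam ^ (5 / 4 : ℝ) := by
  have hn0 : (0 : ℝ) < n := by exact_mod_cast hn
  have hl0 : 0 < lam := lt_of_lt_of_le (by positivity) hl
  refine (hZ.integral_roughness_le hf σ n hl0).trans ?_
  have hK : 0 ≤ ∫ u in (0 : ℝ)..1, f2 u ^ 2 :=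
    intervalIntegral.integral_nonneg zero_le_one fun u _ => sq_nonneg _
  have h1 : (1 : ℝ) ≤ a ^ (-(5 / 4) : ℝ) * ((n : ℝ) ^ (1 / 4 : ℝ) * lam ^ (5 / 4 : ℝ)) := by
    calc (1 : ℝ) = a ^ (-(5 / 4) : ℝ) * ((n : ℝ) ^ (1 / 4 : ℝ) *
          (a * (n : ℝ) ^ (-(1 / 5) : ℝ)) ^ (5 / 4 : ℝ)) := by
          rw [Real.mul_rpow ha.le (by positivity), ← Real.rpow_mul hn0.le, Real.rpow_neg ha.le,
            show -(1 / 5) * (5 / 4) = -(1 / 4 : ℝ) by norm_num, Real.rpow_neg hn0.le]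
          field_simp
      _ ≤ _ := by gcongr
  have h2 := mul_le_mul_of_nonneg_left h1 hK
  linarith

end Noise

/-! ### Normalized sums of residuals -/

lemma dotProduct_residual_comm (n : ℕ) (lam : ℝ) (x y : Fin n → ℝ) :
    x ⬝ᵥ residual n lam y = residual n lam x ⬝ᵥ y := by
  have hT : ((lam • (1 : Matrix (Fin n) (Fin n) ℝ) + roughnessMatrix n)⁻¹)ᵀ =
      (lam • (1 : Matrix (Fin n) (Fin n) ℝ) + roughnessMatrix n)⁻¹ := by
    rw [Matrix.transpose_nonsing_inv, Matrix.transpose_add, Matrix.transpose_smul,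
      Matrix.transpose_one, roughnessMatrix_transpose]
  have h := dotProduct_mulVec_comm_of_transpose hT x y
  rw [residual, residual, dotProduct_sub, sub_dotProduct, splineFit, splineFit, dotProduct_smul,
    smul_dotProduct, h, dotProduct_comm y]

/-- The unit vector that averages over the design points in `I`; it is zero if there are none. -/
def averagingVector (n : ℕ) (I : Set ℝ) : Fin n → ℝ :=
  fun i => open Classical in if i ∈ pointsIn n I then 1 / √((pointsIn n I).card : ℝ) else 0

lemma residualSum_eq_dotProduct (n : ℕ) (lam : ℝ) (y : Fin n → ℝ) (I : Set ℝ) :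
    residualSum n y I (splineFit n lam y) = averagingVector n I ⬝ᵥ residual n lam y := by
  classical
  simp only [residualSum, averagingVector, dotProduct, residual, Finset.mul_sum, ite_mul, zero_mul,
    Finset.sum_ite_mem, Finset.univ_inter, Pi.sub_apply]

lemma averagingVector_sq_le (n : ℕ) (I : Set ℝ) :
    averagingVector n I ⬝ᵥ averagingVector n I ≤ 1 := by
  classical
  have h : averagingVector n I ⬝ᵥ averagingVector n I =
      (pointsIn n I).card * (1 / √((pointsIn n I).card : ℝ)) ^ 2 := by
    simp [averagingVector, dotProduct, pow_two]
  rw [h, div_pow, Real.sq_sqrt (Nat.cast_nonneg _), one_pow]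
  rw [mul_one_div]
  exact div_self_le_one _

lemma abs_residualSum_le {Ω : Type*} (f : ℝ → ℝ) {σ : ℝ} (hσ : 0 < σ) (Z : ℝ → Ω → ℝ) (n : ℕ)
    (lam : ℝ) (I : Set ℝ) (ω : Ω) :
    |residualSum n (observations f σ Z n ω) I (splineFit n lam (observations f σ Z n ω))| ≤
      √(residual n lam (fun i => f (designPoint n i)) ⬝ᵥ
        residual n lam (fun i => f (designPoint n i)))
      + σ * |residual n lam (averagingVector n I) ⬝ᵥ noise Z n ω| := by
  rw [residualSum_eq_dotProduct, observations_eq, residual_add, residual_smul, dotProduct_add,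
    dotProduct_smul, dotProduct_residual_comm n lam _ (noise Z n ω), smul_eq_mul]
  refine (abs_add_le _ _).trans (add_le_add ?_ ?_)
  · refine Real.abs_le_sqrt ((dotProduct_sq_le _ _).trans ?_)
    exact mul_le_of_le_one_left (zero_le_dotProduct_self _) (averagingVector_sq_le n I)
  · rw [abs_mul, abs_of_pos hσ]

/-! ### Piecewise linear interpolation by hat functions -/

lemma hat_nonneg (n k : ℕ) (u : ℝ) : 0 ≤ hat n k u := by
  refine mul_nonneg (Nat.cast_nonneg n) ?_
  have h1 := le_max_left (((k : ℝ) + 1) / n - u) 0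
  have h2 := le_max_right (((k : ℝ) + 1) / n - u) 0
  have h3 := le_max_left (((k : ℝ) + 3) / n - u) 0
  have h4 := le_max_right (((k : ℝ) + 3) / n - u) 0
  have e : ((k : ℝ) + 2) / n - u = ((((k : ℝ) + 1) / n - u) + (((k : ℝ) + 3) / n - u)) / 2 := by
    ring
  rcases le_total (((k : ℝ) + 2) / n - u) 0 with h | h
  · rw [max_eq_right h]
    linarith
  · rw [max_eq_left h]
    linarith

lemma hat_eq_zero_of_lt_abs {n : ℕ} (k : ℕ) {u : ℝ}
    (h : 1 / (n : ℝ) < |u - ((k : ℝ) + 2) / n|) : hat n k u = 0 := by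
  have e1 : ((k : ℝ) + 1) / n - u = -(u - ((k : ℝ) + 2) / n) - 1 / n := by ring
  have e2 : ((k : ℝ) + 2) / n - u = -(u - ((k : ℝ) + 2) / n) := by ring
  have e3 : ((k : ℝ) + 3) / n - u = -(u - ((k : ℝ) + 2) / n) + 1 / n := by ring
  have hn : (0 : ℝ) ≤ 1 / n := by positivity
  rw [hat, e1, e2, e3]
  rcases lt_abs.1 h with h | h
  · rw [max_eq_right (by linarith), max_eq_right (by linarith), max_eq_right (by linarith)]
    ring
  · rw [max_eq_left (by linarith), max_eq_left (by linarith), max_eq_left (by linarith)]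
    ring

lemma sum_hat (n : ℕ) (u : ℝ) : ∀ m : ℕ, ∑ k ∈ Finset.range m, hat n k u =
    n * ((max (((m : ℝ) + 2) / n - u) 0 - max (((m : ℝ) + 1) / n - u) 0)
      - (max (2 / (n : ℝ) - u) 0 - max (1 / (n : ℝ) - u) 0))
  | 0 => by simp
  | m + 1 => by
    rw [Finset.sum_range_succ, sum_hat n u m, hat]
    push_cast
    rw [show (m : ℝ) + 1 + 2 = m + 3 by ring, show (m : ℝ) + 1 + 1 = m + 2 by ring]
    ring

lemma sum_hat_eq {n : ℕ} (hn : 2 ≤ n) (u : ℝ) : ∑ k : Fin (n - 2), hat n k u =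
    n * ((max (1 - u) 0 - max (1 - 1 / (n : ℝ) - u) 0)
      - (max (2 / (n : ℝ) - u) 0 - max (1 / (n : ℝ) - u) 0)) := by
  have hn0 : (n : ℝ) ≠ 0 := by exact_mod_cast (by omega : n ≠ 0)
  rw [Fin.sum_univ_eq_sum_range (fun k => hat n k u), sum_hat]
  push_cast [hn]
  rw [show (n : ℝ) - 2 + 2 = n by ring, div_self hn0, show ((n : ℝ) - 2 + 1) / n = 1 - 1 / n by
    field_simp; ring]

lemma sum_hat_le_one {n : ℕ} (hn : 2 ≤ n) (u : ℝ) : ∑ k : Fin (n - 2), hat n k u ≤ 1 := by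
  have hn0 : (0 : ℝ) < n := by exact_mod_cast (by omega : 0 < n)
  rw [sum_hat_eq hn]
  have h1 : max (1 - u) 0 - max (1 - 1 / (n : ℝ) - u) 0 ≤ 1 / n := by
    rw [sub_le_iff_le_add]
    refine max_le ?_ (by positivity)
    linarith [le_max_left (1 - 1 / (n : ℝ) - u) 0]
  have h2 : max (1 / (n : ℝ) - u) 0 ≤ max (2 / (n : ℝ) - u) 0 := by
    refine max_le_max (sub_le_sub_right ?_ u) le_rfl
    gcongr
    norm_num
  calc _ ≤ (n : ℝ) * (1 / n) := by
        gcongr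
        linarith
    _ = 1 := by field_simp

lemma sum_hat_eq_one {n : ℕ} (hn : 2 ≤ n) {u : ℝ} (h1 : 2 / (n : ℝ) ≤ u)
    (h2 : u ≤ 1 - 1 / n) : ∑ k : Fin (n - 2), hat n k u = 1 := by
  have hn0 : (0 : ℝ) < n := by exact_mod_cast (by omega : 0 < n)
  have h3 : (1 : ℝ) / n ≤ 2 / n := by
    gcongr
    norm_num
  have h4 : (0 : ℝ) < 1 / n := by positivity
  rw [sum_hat_eq hn, max_eq_left (by linarith), max_eq_left (by linarith),
    max_eq_right (by linarith), max_eq_right (by linarith)]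
  field_simp
  ring

/-- The values of `h` at the interior design points. -/
def interiorValues (n : ℕ) (h : ℝ → ℝ) : Fin (n - 2) → ℝ := fun k => h (((k : ℝ) + 2) / n)

/-- A Lipschitz function that vanishes outside `(0, 1)` is close to its piecewise linear interpolant
at the interior design points. The boundary condition matters: no hat function is centred at the
first or the last design point. -/
lemma abs_sub_splineSecond_le {h : ℝ → ℝ} {L : NNReal} (hL : LipschitzWith L h)
    (h0 : h 0 = 0) (h1 : h 1 = 0) {n : ℕ} (hn : 2 ≤ n) {u : ℝ} (hu : u ∈ Set.Icc (0 : ℝ) 1) :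
    |h u - splineSecond n (interiorValues n h) u| ≤ 3 * L / n := by
  have hn0 : (0 : ℝ) < n := by exact_mod_cast (by omega : 0 < n)
  have hLip : ∀ x y : ℝ, |h x - h y| ≤ L * |x - y| := fun x y => by
    simpa [Real.dist_eq] using hL.dist_le_mul x y
  set Φ := ∑ k : Fin (n - 2), hat n k u with hΦ
  have hΦ1 : Φ ≤ 1 := sum_hat_le_one hn u
  have hΦ0 : 0 ≤ Φ := Finset.sum_nonneg fun k _ => hat_nonneg n k u
  have e : h u - splineSecond n (interiorValues n h) u =
      h u * (1 - Φ) + ∑ k : Fin (n - 2), (h u - h (((k : ℝ) + 2) / n)) * hat n k u := by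
    simp only [splineSecond, interiorValues, sub_mul, Finset.sum_sub_distrib, ← Finset.mul_sum]
    rw [← hΦ]
    ring
  have b1 : |h u * (1 - Φ)| ≤ 2 * L / n := by
    have hle : |1 - Φ| ≤ 1 := abs_le.2 ⟨by linarith, by linarith⟩
    rcases lt_or_ge u (2 / (n : ℝ)) with hu1 | hu1
    · have := hLip u 0
      rw [h0, sub_zero, sub_zero, abs_of_nonneg hu.1] at this
      calc _ = |h u| * |1 - Φ| := abs_mul _ _
        _ ≤ (L * (2 / n)) * 1 := by
            gcongr
            exact this.trans (by gcongr)
        _ = _ := by ring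
    · rcases le_or_gt u (1 - 1 / (n : ℝ)) with hu2 | hu2
      · rw [hΦ, sum_hat_eq_one hn hu1 hu2, sub_self, mul_zero, abs_zero]
        positivity
      · have := hLip u 1
        rw [h1, sub_zero, abs_sub_comm u 1, abs_of_nonneg (sub_nonneg.2 hu.2)] at this
        calc _ = |h u| * |1 - Φ| := abs_mul _ _
          _ ≤ (L * (2 / n)) * 1 := by
              gcongr
              refine this.trans ?_
              gcongr
              have : (1 : ℝ) / n ≤ 2 / n := by
                gcongr
                norm_num
              linarith
          _ = _ := by ring
  have b2 : |∑ k : Fin (n - 2), (h u - h (((k : ℝ) + 2) / n)) * hat n k u| ≤ L / n := by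
    calc _ ≤ ∑ k : Fin (n - 2), |(h u - h (((k : ℝ) + 2) / n)) * hat n k u| :=
          Finset.abs_sum_le_sum_abs _ _
      _ ≤ ∑ k : Fin (n - 2), L / n * hat n k u := by
          refine Finset.sum_le_sum fun k _ => ?_
          rw [abs_mul, abs_of_nonneg (hat_nonneg n k u)]
          rcases lt_or_ge (1 / (n : ℝ)) |u - ((k : ℝ) + 2) / n| with hk | hk
          · rw [hat_eq_zero_of_lt_abs _ hk, mul_zero, mul_zero]
          · refine mul_le_mul_of_nonneg_right ((hLip _ _).trans ?_) (hat_nonneg n k u)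
            calc _ ≤ (L : ℝ) * (1 / n) := by gcongr
              _ = _ := by ring
      _ = L / n * Φ := by rw [Finset.mul_sum]
      _ ≤ L / n := mul_le_of_le_one_right (by positivity) hΦ1
  rw [e]
  calc _ ≤ _ := abs_add_le _ _
    _ ≤ 2 * (L : ℝ) / n + L / n := add_le_add b1 b2
    _ = _ := by ring

/-! ### Approximation of the second derivative by smooth functions -/

lemma exists_abs_second_difference_le {h : ℝ → ℝ} (hc : HasCompactSupport h) (hh : ContDiff ℝ 2 h) :
    ∃ M : NNReal, ∀ t d : ℝ, |h t - 2 * h (t + d) + h (t + 2 * d)| ≤ M * d ^ 2 := by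
  have h1 : ContDiff ℝ 1 (deriv h) := by
    rw [show (2 : WithTop ℕ∞) = 1 + 1 by norm_num] at hh
    exact (contDiff_succ_iff_deriv.1 hh).2.2
  obtain ⟨M, hM⟩ := ContDiff.lipschitzWith_of_hasCompactSupport hc.deriv h1 one_ne_zero
  refine ⟨M, fun t d => ?_⟩
  have hd : Differentiable ℝ h := hh.differentiable (by norm_num)
  have hφ : ∀ x : ℝ, HasDerivAt (fun x => h (x + d) - h x) (deriv h (x + d) - deriv h x) x := by
    intro x
    exact ((hd (x + d)).hasDerivAt.comp_add_const x d).sub (hd x).hasDerivAt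
  have hL : LipschitzWith (M * ‖d‖₊) (fun x => h (x + d) - h x) := by
    refine lipschitzWith_of_nnnorm_deriv_le (fun x => (hφ x).differentiableAt) fun x => ?_
    rw [(hφ x).deriv]
    have := hM.dist_le_mul (x + d) x
    simp only [dist_eq_norm, add_sub_cancel_left] at this
    exact_mod_cast this
  have := hL.dist_le_mul (t + d) t
  simp only [dist_eq_norm, add_sub_cancel_left, NNReal.coe_mul, coe_nnnorm, Real.norm_eq_abs] at this
  rw [mul_assoc, abs_mul_abs_self, ← pow_two] at this
  convert this using 2
  rw [show t + d + d = t + 2 * d by ring]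
  ring

lemma intervalIntegral_sq_le_of_eLpNorm_le {g : ℝ → ℝ}
    (hg : MemLp g 2 (volume.restrict (Set.Icc (0 : ℝ) 1))) {ε : ℝ} (hε : 0 ≤ ε)
    (h : eLpNorm g 2 (volume.restrict (Set.Icc (0 : ℝ) 1)) ≤ ENNReal.ofReal ε) :
    ∫ u in (0 : ℝ)..1, g u ^ 2 ≤ ε ^ 2 := by
  rw [hg.eLpNorm_eq_integral_rpow_norm (by norm_num) (by norm_num),
    ENNReal.ofReal_le_ofReal_iff hε] at h
  rw [intervalIntegral.integral_of_le zero_le_one, ← integral_Icc_eq_integral_Ioc]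
  have e : ∀ u, ‖g u‖ ^ (ENNReal.toReal 2) = g u ^ 2 := fun u => by
    rw [ENNReal.toReal_ofNat, Real.rpow_ofNat, Real.norm_eq_abs, sq_abs]
  simp only [e] at h
  have h0 : 0 ≤ ∫ u in Set.Icc (0 : ℝ) 1, g u ^ 2 := integral_nonneg fun _ => sq_nonneg _
  calc _ = ((∫ u in Set.Icc (0 : ℝ) 1, g u ^ 2) ^ (ENNReal.toReal 2)⁻¹) ^ 2 := by
        rw [← Real.rpow_natCast, ← Real.rpow_mul h0]
        norm_num
    _ ≤ ε ^ 2 := by gcongr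

/-- Smooth functions that vanish outside `(0, 1)` are dense in `L²(0, 1)`. -/
lemma exists_smooth_approx {g2 : ℝ → ℝ} (hg : MemLp g2 2 (volume.restrict (Set.Icc (0 : ℝ) 1)))
    {ε : ℝ} (hε : 0 < ε) : ∃ h : ℝ → ℝ, HasCompactSupport h ∧ ContDiff ℝ 2 h ∧
      (∀ t ∉ Set.Ioo (0 : ℝ) 1, h t = 0) ∧ ∫ u in (0 : ℝ)..1, (g2 u - h u) ^ 2 ≤ ε := by
  have hε4 : 0 < √(ε / 4) := by positivity
  obtain ⟨g, hgc, hgs, hge⟩ := hg.exist_eLpNorm_sub_le (by norm_num) (by norm_num) hε4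
  have hgcont : Continuous g := hgs.continuous
  obtain ⟨B, hB⟩ := hgc.exists_bound_of_continuous hgcont
  have hgm : MemLp g 2 (volume.restrict (Set.Icc (0 : ℝ) 1)) :=
    (memLp_two_iff_integrable_sq hgcont.aestronglyMeasurable).2
      (hgcont.pow 2).continuousOn.integrableOn_Icc
  have h1 := intervalIntegral_sq_le_of_eLpNorm_le (hg.sub hgm) hε4.le hge
  rw [Real.sq_sqrt (by positivity)] at h1
  -- the cutoff removes from `g` at most `2 * δ * B ^ 2`, and the choice of `δ` makes this small
  set δ : ℝ := min (1 / 4) (ε / (8 * (B ^ 2 + 1))) with hδ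
  have hδ0 : 0 < δ := by positivity
  have hδ1 : δ ≤ 1 / 4 := min_le_left _ _
  have hδ2 : δ * B ^ 2 ≤ ε / 8 := by
    calc δ * B ^ 2 ≤ ε / (8 * (B ^ 2 + 1)) * (B ^ 2 + 1) := by
          gcongr
          · exact min_le_right _ _
          · linarith
      _ = ε / 8 := by field_simp
  let χ : ContDiffBump (1 / 2 : ℝ) := ⟨1 / 2 - δ, 1 / 2, by linarith, by linarith⟩
  have hχ1 : ∀ u ∈ Set.Icc δ (1 - δ), χ u = 1 := fun u hu => by
    refine χ.one_of_mem_closedBall ?_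
    rw [Metric.mem_closedBall, Real.dist_eq, abs_le]
    change -(1 / 2 - δ) ≤ _ ∧ _ ≤ 1 / 2 - δ
    exact ⟨by linarith [hu.1], by linarith [hu.2]⟩
  refine ⟨fun u => χ u * g u, hgc.mul_left, χ.contDiff.mul (hgs.of_le (by exact_mod_cast le_top)),
    fun t ht => ?_, ?_⟩
  · refine mul_eq_zero_of_left (χ.zero_of_le_dist ?_) _
    change 1 / 2 ≤ _
    rw [Real.dist_eq]
    by_contra hlt
    rw [not_le, abs_lt] at hlt
    exact ht ⟨by linarith [hlt.1], by linarith [hlt.2]⟩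
  · set k : ℝ → ℝ := fun u => (1 - χ u) * g u with hk
    have hkc : Continuous k := (continuous_const.sub χ.continuous).mul hgcont
    have hkB : ∀ u, ‖k u ^ 2‖ ≤ B ^ 2 := by
      intro u
      rw [norm_pow]
      have : ‖k u‖ ≤ B := by
        rw [hk, norm_mul]
        have : ‖1 - χ u‖ ≤ 1 := by
          rw [Real.norm_eq_abs, abs_le]
          exact ⟨by linarith [χ.le_one (x := u)], by linarith [χ.nonneg (x := u)]⟩
        calc _ ≤ 1 * ‖g u‖ := by gcongr
          _ ≤ B := by rw [one_mul]; exact hB u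
      gcongr
    have ik : ∀ a b : ℝ, IntervalIntegrable (fun u => k u ^ 2) volume a b := fun a b =>
      (hkc.pow 2).intervalIntegrable a b
    have hk2 : ∫ u in (0 : ℝ)..1, k u ^ 2 ≤ ε / 4 := by
      rw [← intervalIntegral.integral_add_adjacent_intervals (ik 0 δ) (ik δ 1),
        ← intervalIntegral.integral_add_adjacent_intervals (ik δ (1 - δ)) (ik (1 - δ) 1)]
      have z : ∫ u in δ..(1 - δ), k u ^ 2 = 0 := by
        rw [intervalIntegral.integral_congr (g := fun _ => (0 : ℝ)), intervalIntegral.integral_zero]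
        intro u hu
        rw [Set.uIcc_of_le (by linarith)] at hu
        simp [hk, hχ1 u hu]
      have a1 := intervalIntegral.norm_integral_le_of_norm_le_const (a := 0) (b := δ)
        (f := fun u => k u ^ 2) fun u _ => hkB u
      have a2 := intervalIntegral.norm_integral_le_of_norm_le_const (a := 1 - δ) (b := 1)
        (f := fun u => k u ^ 2) fun u _ => hkB u
      rw [sub_zero, abs_of_pos hδ0] at a1
      rw [sub_sub_cancel, abs_of_pos hδ0] at a2
      have a1' := (le_abs_self _).trans a1
      have a2' := (le_abs_self _).trans a2
      rw [z]
      linarith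
    have iw : IntervalIntegrable (fun u => (g2 u - g u) ^ 2) volume 0 1 := by
      rw [intervalIntegrable_iff_integrableOn_Icc_of_le zero_le_one]
      exact (hg.sub hgm).integrable_sq
    calc ∫ u in (0 : ℝ)..1, (g2 u - χ u * g u) ^ 2
        ≤ ∫ u in (0 : ℝ)..1, (2 * (g2 u - g u) ^ 2 + 2 * k u ^ 2) := by
          refine intervalIntegral.integral_mono_on zero_le_one ?_
            ((iw.const_mul 2).add ((ik 0 1).const_mul 2)) fun u _ => ?_
          · rw [intervalIntegrable_iff_integrableOn_Icc_of_le zero_le_one]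
            refine (hg.sub ((memLp_two_iff_integrable_sq ?_).2
              ((χ.continuous.mul hgcont).pow 2).continuousOn.integrableOn_Icc)).integrable_sq
            exact (χ.continuous.mul hgcont).aestronglyMeasurable
          · have : g2 u - χ u * g u = (g2 u - g u) + k u := by
              simp only [hk]
              ring
            rw [this]
            nlinarith [sq_nonneg ((g2 u - g u) - k u)]
      _ = 2 * (∫ u in (0 : ℝ)..1, (g2 u - g u) ^ 2) + 2 * ∫ u in (0 : ℝ)..1, k u ^ 2 := by
          rw [intervalIntegral.integral_add (iw.const_mul 2) ((ik 0 1).const_mul 2),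
            intervalIntegral.integral_const_mul, intervalIntegral.integral_const_mul]
      _ ≤ 2 * (ε / 4) + 2 * (ε / 4) := by gcongr; exact h1
      _ = ε := by ring

/-! ### The bias of the fit -/

/-- The interior values of `h`, extended by zero, differ from the values of `h` on the grid at most
at the first design point `1 / n`, where `h` is of the order `n ^ (-2)`. -/
lemma abs_zeroExtend_interiorValues_sub_le {h : ℝ → ℝ} (hz : ∀ t ∉ Set.Ioo (0 : ℝ) 1, h t = 0)
    {M : NNReal} (hM : ∀ t d : ℝ, |h t - 2 * h (t + d) + h (t + 2 * d)| ≤ M * d ^ 2) {n : ℕ}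
    (hn : 0 < n) (j : ℕ) :
    |zeroExtend n (interiorValues n h) j - h ((j : ℝ) / n)| ≤ M * (1 / (n : ℝ)) ^ 2 := by
  have hn0 : (0 : ℝ) < n := by exact_mod_cast hn
  rw [zeroExtend]
  split_ifs with h2
  · simp only [interiorValues]
    push_cast [h2.1]
    rw [sub_add_cancel, sub_self, abs_zero]
    positivity
  · rw [zero_sub, abs_neg]
    rcases eq_or_ne j 1 with rfl | hj
    · have h1 := hM (-(1 / (n : ℝ))) (1 / n)
      have hneg : -(1 / (n : ℝ)) < 0 := by
        rw [neg_lt_zero]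
        positivity
      rw [hz _ fun h' => hneg.not_gt h'.1, neg_add_cancel, hz 0 (by simp)] at h1
      rw [Nat.cast_one]
      convert h1 using 2
      rw [show -(1 / (n : ℝ)) + 2 * (1 / n) = 1 / n by ring]
      ring
    · rw [hz, abs_zero]
      · positivity
      rintro ⟨h3, h4⟩
      have h5 : j < n := by
        rw [div_lt_one hn0] at h4
        exact_mod_cast h4
      have h6 : j ≠ 0 := by
        rintro rfl
        simp at h3
      omega

lemma differenceMatrix_mulVec_interiorValues_sq_le {h : ℝ → ℝ}
    (hz : ∀ t ∉ Set.Ioo (0 : ℝ) 1, h t = 0) {M : NNReal}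
    (hM : ∀ t d : ℝ, |h t - 2 * h (t + d) + h (t + 2 * d)| ≤ M * d ^ 2) {n : ℕ} (hn : 0 < n) :
    (differenceMatrix n *ᵥ interiorValues n h) ⬝ᵥ (differenceMatrix n *ᵥ interiorValues n h) ≤
      25 * M ^ 2 / n := by
  have hn0 : (0 : ℝ) < n := by exact_mod_cast hn
  rw [differenceMatrix_mulVec_sq]
  set X := zeroExtend n (interiorValues n h) with hX
  have hb : ∀ i ∈ Finset.range n, (X i - 2 * X (i + 1) + X (i + 2)) ^ 2 ≤
      (5 * (M * (1 / (n : ℝ)) ^ 2)) ^ 2 := by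
    intro i _
    refine sq_le_sq' ?_ ?_
    all_goals
      have e0 := abs_le.1 (abs_zeroExtend_interiorValues_sub_le hz hM hn i)
      have e1 := abs_le.1 (abs_zeroExtend_interiorValues_sub_le hz hM hn (i + 1))
      have e2 := abs_le.1 (abs_zeroExtend_interiorValues_sub_le hz hM hn (i + 2))
      have e := abs_le.1 (hM ((i : ℝ) / n) (1 / n))
      rw [← hX] at e0 e1 e2
      push_cast at e1 e2
      rw [show (i : ℝ) / n + 1 / n = (i + 1) / n by ring,
        show (i : ℝ) / n + 2 * (1 / n) = (i + 2) / n by ring] at e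
      linarith [e0.1, e0.2, e1.1, e1.2, e2.1, e2.2, e.1, e.2]
  calc _ ≤ (n : ℝ) ^ 2 * ∑ i ∈ Finset.range n, (5 * (M * (1 / (n : ℝ)) ^ 2)) ^ 2 := by
        exact mul_le_mul_of_nonneg_left (Finset.sum_le_sum hb) (sq_nonneg _)
    _ = _ := by
        rw [Finset.sum_const, Finset.card_range, nsmul_eq_mul]
        field_simp
        ring

lemma HasL2SecondDeriv.integral_sub_interpolant_sq_le {f f2 h : ℝ → ℝ}
    (hf : HasL2SecondDeriv f f2) (hc : Continuous h) {L : NNReal} (hL : LipschitzWith L h)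
    (hz : ∀ t ∉ Set.Ioo (0 : ℝ) 1, h t = 0) {n : ℕ} (hn : 2 ≤ n) :
    ∫ u in (0 : ℝ)..1, (f2 u - splineSecond n (interiorValues n h) u) ^ 2 ≤
      2 * (∫ u in (0 : ℝ)..1, (f2 u - h u) ^ 2) + 2 * (3 * L / n) ^ 2 := by
  obtain ⟨g, hg⟩ := exists_hasL2SecondDeriv_of_continuous hc
  obtain ⟨s, hs⟩ := exists_hasL2SecondDeriv_of_continuous
    (continuous_splineSecond n (interiorValues n h))
  have i1 := (hf.sub hg).intervalIntegrable_sq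
  calc _ ≤ ∫ u in (0 : ℝ)..1, (2 * (f2 u - h u) ^ 2 + 2 * (3 * (L : ℝ) / n) ^ 2) := by
        refine intervalIntegral.integral_mono_on zero_le_one (hf.sub hs).intervalIntegrable_sq
          ((i1.const_mul 2).add intervalIntegrable_const) fun u hu => ?_
        have hb := abs_sub_splineSecond_le hL (hz 0 (by simp)) (hz 1 (by simp)) hn hu
        have hb2 := sq_le_sq' (abs_le.1 hb).1 (abs_le.1 hb).2
        nlinarith [sq_nonneg ((f2 u - h u) - (h u - splineSecond n (interiorValues n h) u))]
    _ = _ := by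
        rw [intervalIntegral.integral_add (i1.const_mul 2) intervalIntegrable_const,
          intervalIntegral.integral_const_mul]
        simp

/-- The squared bias is of smaller order than `1 / lam`. The signal is split into a natural spline
whose second derivative interpolates a smooth function close to `f''`, which the fit reproduces up
to order `1 / (√n lam)`, and a remainder of small roughness. -/
lemma HasL2SecondDeriv.exists_residual_sq_le {f f2 : ℝ → ℝ} (hf : HasL2SecondDeriv f f2) {ε : ℝ}
    (hε : 0 < ε) : ∃ C : ℝ, 0 ≤ C ∧ ∀ n : ℕ, 2 ≤ n → ∀ lam : ℝ, 0 < lam →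
      residual n lam (fun i => f (designPoint n i)) ⬝ᵥ
        residual n lam (fun i => f (designPoint n i)) ≤ (ε + C / n) / lam + C / (n * lam ^ 2) := by
  obtain ⟨h, hc, hs, hz, hh⟩ := exists_smooth_approx hf.1 (show 0 < ε / 4 by positivity)
  obtain ⟨M, hM⟩ := exists_abs_second_difference_le hc hs
  obtain ⟨L, hL⟩ := ContDiff.lipschitzWith_of_hasCompactSupport hc hs (by norm_num)
  refine ⟨36 * L ^ 2 + 50 * M ^ 2, by positivity, fun n hn lam hl => ?_⟩
  have hn0 : (0 : ℝ) < n := by exact_mod_cast (by omega : 0 < n)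
  have hn1 : (1 : ℝ) ≤ n := by exact_mod_cast (by omega : 1 ≤ n)
  set γ := interiorValues n h with hγ
  obtain ⟨g, hg⟩ := exists_hasL2SecondDeriv_of_continuous (continuous_splineSecond n γ)
  set x : Fin n → ℝ := fun i => f (designPoint n i) with hx
  set v : Fin n → ℝ := fun i => g (designPoint n i) with hv
  have hΩ : roughnessMatrix n *ᵥ v = differenceMatrix n *ᵥ γ := by
    rw [roughnessMatrix_mulVec_eq, knotSecondDeriv_eq hg.differences_eq_mulVec]
  have h1 : lam ^ 2 * (residual n lam v ⬝ᵥ residual n lam v) ≤ 25 * M ^ 2 / n := by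
    refine (sq_mul_residual_sq_le n hl v).trans ?_
    rw [hΩ]
    exact differenceMatrix_mulVec_interiorValues_sq_le hz hM (by omega)
  have h2 : lam * (residual n lam (x - v) ⬝ᵥ residual n lam (x - v)) ≤
      ε / 2 + 18 * L ^ 2 / n := by
    refine (mul_residual_sq_le_roughness n hl (x - v)).trans (((hf.sub hg).roughness_le n).trans
      ((hf.integral_sub_interpolant_sq_le hs.continuous hL hz hn).trans ?_))
    have : (1 : ℝ) / n ^ 2 ≤ 1 / n := by
      gcongr
      exact le_self_pow₀ hn1 (by norm_num)
    calc _ ≤ 2 * (ε / 4) + 18 * L ^ 2 * (1 / n ^ 2) := by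
          refine add_le_add (by gcongr) (le_of_eq ?_)
          ring
      _ ≤ 2 * (ε / 4) + 18 * L ^ 2 * (1 / n) := by gcongr
      _ = _ := by ring
  have h3 : residual n lam x = residual n lam (x - v) + residual n lam v := by
    rw [← residual_add, sub_add_cancel]
  set p := residual n lam (x - v)
  set r := residual n lam v
  have h4 : residual n lam x ⬝ᵥ residual n lam x ≤ 2 * (p ⬝ᵥ p) + 2 * (r ⬝ᵥ r) := by
    have := zero_le_dotProduct_self (p - r)
    rw [h3]
    simp only [sub_dotProduct, dotProduct_sub, add_dotProduct, dotProduct_add,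
      dotProduct_comm r p] at this ⊢
    linarith
  have h5 : p ⬝ᵥ p ≤ (ε / 2 + 18 * L ^ 2 / n) / lam := by
    rw [le_div_iff₀ hl]
    linarith
  have h6 : r ⬝ᵥ r ≤ 25 * M ^ 2 / n / lam ^ 2 := by
    rw [le_div_iff₀ (by positivity)]
    linarith
  calc _ ≤ _ := h4
    _ ≤ 2 * ((ε / 2 + 18 * L ^ 2 / n) / lam) + 2 * (25 * M ^ 2 / n / lam ^ 2) := by gcongr
    _ = (ε + 36 * L ^ 2 / n) / lam + 50 * M ^ 2 / (n * lam ^ 2) := by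
        field_simp
        ring
    _ ≤ _ := by
        gcongr
        · linarith [show (0 : ℝ) ≤ 50 * M ^ 2 by positivity]
        · linarith [show (0 : ℝ) ≤ 36 * L ^ 2 by positivity]

/-- For weights of order larger than `1 / log n` the bias is of smaller order than `√(log n)`. -/
lemma HasL2SecondDeriv.eventually_residual_sq_le {f f2 : ℝ → ℝ} (hf : HasL2SecondDeriv f f2)
    {lam : ℕ → ℝ} (hlam : ∀ᶠ n : ℕ in atTop, 1 / Real.log n < lam n) {ε : ℝ} (hε : 0 < ε) :
    ∀ᶠ n : ℕ in atTop, 0 < lam n ∧ residual n (lam n) (fun i => f (designPoint n i)) ⬝ᵥ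
        residual n (lam n) (fun i => f (designPoint n i)) ≤ 2 * ε * Real.log n := by
  obtain ⟨C, hC0, hC⟩ := hf.exists_residual_sq_le hε
  have t1 : Tendsto (fun n : ℕ => C / (n : ℝ) + C * (Real.log n / n)) atTop (𝓝 0) := by
    have a := tendsto_const_div_atTop_nhds_zero_nat C
    have b : Tendsto (fun n : ℕ => Real.log n / n) atTop (𝓝 0) :=
      (Real.isLittleO_log_id_atTop.tendsto_div_nhds_zero).comp tendsto_natCast_atTop_atTop
    simpa using a.add (b.const_mul C)
  filter_upwards [hlam, t1.eventually (gt_mem_nhds hε), eventually_ge_atTop 2] with n h1 h2 h3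
  have hn0 : (0 : ℝ) < n := by exact_mod_cast (by omega : 0 < n)
  have hlog : 0 < Real.log n := Real.log_pos (by exact_mod_cast (by omega : 1 < n))
  have hl : 0 < lam n := lt_trans (by positivity) h1
  have hinv : 1 / lam n ≤ Real.log n := by
    rw [div_le_iff₀ hl]
    rw [div_lt_iff₀ hlog] at h1
    linarith
  refine ⟨hl, (hC n h3 (lam n) hl).trans ?_⟩
  calc (ε + C / n) / lam n + C / (n * lam n ^ 2)
      = (ε + C / n) * (1 / lam n) + C / n * (1 / lam n) ^ 2 := by field_simp
    _ ≤ (ε + C / n) * Real.log n + C / n * Real.log n ^ 2 := by gcongr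
    _ = (ε + (C / n + C * (Real.log n / n))) * Real.log n := by ring
    _ ≤ (ε + ε) * Real.log n := by gcongr
    _ = _ := by ring

/-! ### The residuals satisfy the multiresolution criterion -/

section Residuals

variable {Ω : Type*} [MeasurableSpace Ω] {P : Measure Ω} {Z : ℝ → Ω → ℝ}

/-- A union bound: with high probability all normalized sums of residual noise are small. -/
lemma IsWhiteNoise.measure_exists_residual_noise_le (hZ : IsWhiteNoise Z P) {n : ℕ} {lam : ℝ}
    (hl : 0 < lam) (𝓘 : Finset (Set ℝ)) {ε : ℝ} (hε : 0 ≤ ε) :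
    P {ω | ∃ I ∈ 𝓘, ε ≤ |residual n lam (averagingVector n I) ⬝ᵥ noise Z n ω|} ≤
      ENNReal.ofReal (𝓘.card * (2 * Real.exp (-ε ^ 2 / 2))) := by
  have e : {ω | ∃ I ∈ 𝓘, ε ≤ |residual n lam (averagingVector n I) ⬝ᵥ noise Z n ω|} =
      ⋃ I ∈ 𝓘, {ω | ε ≤ |residual n lam (averagingVector n I) ⬝ᵥ noise Z n ω|} := by
    ext ω
    simp
  rw [e, ENNReal.ofReal_mul (Nat.cast_nonneg _), ENNReal.ofReal_natCast, ← nsmul_eq_mul]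
  refine (measure_biUnion_finset_le _ _).trans (Finset.sum_le_card_nsmul _ _ _ fun I _ => ?_)
  exact hZ.measure_abs_dotProduct_noise_le
    ((residual_sq_le n hl _).trans (averagingVector_sq_le n I)) hε

lemma IsWhiteNoise.tendsto_measure_residualSum_le (hZ : IsWhiteNoise Z P) {f f2 : ℝ → ℝ}
    (hf : HasL2SecondDeriv f f2) {σ : ℝ} (hσ : 0 < σ) {lam : ℕ → ℝ} {q : ℝ}
    {𝓘 : ℕ → Finset (Set ℝ)} {τ : ℝ} (hlam : ∀ᶠ n : ℕ in atTop, 1 / Real.log n < lam n)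
    (hq : ∀ᶠ n : ℕ in atTop, ((𝓘 n).card : ℝ) ≤ q * n) (hτ : 2 < τ) :
    Tendsto (fun n : ℕ => P {ω | ∀ I ∈ 𝓘 n,
      |residualSum n (observations f σ Z n ω) I
        (splineFit n (lam n) (observations f σ Z n ω))| ≤ σ * √(τ * Real.log n)})
      atTop (𝓝 1) := by
  have : IsProbabilityMeasure P := hZ.indep.isProbabilityMeasure
  -- an intermediate threshold: the noise stays below `ρ`, which leaves room for the bias
  set ρ : ℝ := (τ + 2) / 2 with hρ
  have hρ2 : 2 < ρ := by linarith
  have hρτ : ρ < τ := by linarith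
  have hsqrt : √ρ < √τ := Real.sqrt_lt_sqrt (by linarith) hρτ
  set η : ℝ := σ * (√τ - √ρ) with hη
  have hη0 : 0 < η := mul_pos hσ (sub_pos.2 hsqrt)
  have hbias := hf.eventually_residual_sq_le hlam (show 0 < η ^ 2 / 2 by positivity)
  have hlim : Tendsto (fun n : ℕ => 1 - ENNReal.ofReal (2 * q * (n : ℝ) ^ (-(ρ / 2 - 1))))
      atTop (𝓝 1) := by
    have h1 : Tendsto (fun n : ℕ => 2 * q * (n : ℝ) ^ (-(ρ / 2 - 1))) atTop (𝓝 0) := by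
      have := ((tendsto_rpow_neg_atTop (show 0 < ρ / 2 - 1 by linarith)).comp
        tendsto_natCast_atTop_atTop).const_mul (2 * q)
      simpa using this
    have h2 := ENNReal.tendsto_ofReal h1
    rw [ENNReal.ofReal_zero] at h2
    simpa using ENNReal.Tendsto.sub tendsto_const_nhds h2 (Or.inl ENNReal.one_ne_top)
  refine tendsto_of_tendsto_of_tendsto_of_le_of_le' hlim tendsto_const_nhds ?_
    (Eventually.of_forall fun n => prob_le_one)
  filter_upwards [hbias, hq, eventually_ge_atTop 2] with n hb hqn hn
  obtain ⟨hl, hb⟩ := hb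
  have hn0 : (0 : ℝ) < n := by exact_mod_cast (by omega : 0 < n)
  have hlog : 0 < Real.log n := Real.log_pos (by exact_mod_cast (by omega : 1 < n))
  set G := {ω | ∀ I ∈ 𝓘 n, |residualSum n (observations f σ Z n ω) I
        (splineFit n (lam n) (observations f σ Z n ω))| ≤ σ * √(τ * Real.log n)} with hG
  have hbad : Gᶜ ⊆ {ω | ∃ I ∈ 𝓘 n, √(ρ * Real.log n) ≤
      |residual n (lam n) (averagingVector n I) ⬝ᵥ noise Z n ω|} := by
    intro ω hω
    by_contra hcon
    refine hω fun I hI => ?_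
    have hcon' : |residual n (lam n) (averagingVector n I) ⬝ᵥ noise Z n ω| ≤
        √(ρ * Real.log n) := by
      by_contra hlt
      exact hcon ⟨I, hI, (not_le.1 hlt).le⟩
    refine (abs_residualSum_le f hσ Z n (lam n) I ω).trans ?_
    have hb' := Real.sqrt_le_sqrt hb
    rw [show 2 * (η ^ 2 / 2) * Real.log n = η ^ 2 * Real.log n by ring,
      Real.sqrt_mul (sq_nonneg η), Real.sqrt_sq hη0.le] at hb'
    calc _ ≤ η * √(Real.log n) + σ * √(ρ * Real.log n) := by gcongr
      _ = σ * √(τ * Real.log n) := by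
          rw [Real.sqrt_mul (by linarith), Real.sqrt_mul (by linarith), hη]
          ring
  have hP : P Gᶜ ≤ ENNReal.ofReal (2 * q * (n : ℝ) ^ (-(ρ / 2 - 1))) := by
    refine (measure_mono hbad).trans ((hZ.measure_exists_residual_noise_le hl (𝓘 n)
      (Real.sqrt_nonneg _)).trans (ENNReal.ofReal_le_ofReal ?_))
    rw [Real.sq_sqrt (by positivity)]
    calc _ ≤ q * n * (2 * Real.exp (-(ρ * Real.log n) / 2)) := by gcongr
      _ = 2 * q * (n : ℝ) ^ (-(ρ / 2 - 1)) := by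
          rw [show -(ρ / 2 - 1) = 1 + -(ρ / 2) by ring, Real.rpow_add hn0, Real.rpow_one,
            Real.rpow_def_of_pos hn0, show Real.log n * -(ρ / 2) = -(ρ * Real.log n) / 2 by ring]
          ring
  rw [tsub_le_iff_right]
  calc (1 : ENNReal) = P (G ∪ Gᶜ) := by rw [Set.union_compl_self, measure_univ]
    _ ≤ P G + P Gᶜ := measure_union_le _ _
    _ ≤ _ := by gcongr

end Residuals

end SmoothingSpline

end

theorem mainTheorem1 {Ω : Type*} [MeasurableSpace Ω] (P : Measure Ω) [IsProbabilityMeasure P]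
    (Z : ℝ → Ω → ℝ) (hZ : SmoothingSpline.IsWhiteNoise Z P)
    (f f2 : ℝ → ℝ) (hf : SmoothingSpline.HasL2SecondDeriv f f2) (σ : ℝ) (hσ : 0 < σ) :
    -- the explicit vector is the vector of values of the smoothing spline
    (∀ (n : ℕ) (y : Fin n → ℝ) (lam : ℝ), 0 < lam →
      (∃ g g2 : ℝ → ℝ, SmoothingSpline.IsSmoothingSpline n lam y g g2) ∧
      ∀ g g2 : ℝ → ℝ, SmoothingSpline.IsSmoothingSpline n lam y g g2 →
        (∀ i, g (SmoothingSpline.designPoint n i) = SmoothingSpline.splineFit n lam y i) ∧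
        ∫ u in (0 : ℝ)..1, g2 u ^ 2 =
          SmoothingSpline.roughness n (SmoothingSpline.splineFit n lam y)) ∧
    -- (a)
    (∀ (n : ℕ) (y : Fin n → ℝ),
      MonotoneOn (fun lam : ℝ =>
        SmoothingSpline.roughness n (SmoothingSpline.splineFit n lam y)) (Set.Ioi 0) ∧
      ((¬ ∃ a b : ℝ, ∀ i, y i = a + b * SmoothingSpline.designPoint n i) →
        StrictMonoOn (fun lam : ℝ =>
          SmoothingSpline.roughness n (SmoothingSpline.splineFit n lam y)) (Set.Ioi 0))) ∧
    -- (b)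
    (∀ (n : ℕ) (lam : ℝ), 0 < lam →
      Integrable (fun ω => SmoothingSpline.roughness n
        (SmoothingSpline.splineFit n lam (SmoothingSpline.observations f σ Z n ω))) P) ∧
    (∃ c : ℝ, ∀ (n : ℕ) (lam : ℝ), 0 < lam →
      ∫ ω, SmoothingSpline.roughness n
        (SmoothingSpline.splineFit n lam (SmoothingSpline.observations f σ Z n ω)) ∂P ≤
        (∫ u in (0 : ℝ)..1, f2 u ^ 2) + c * (n : ℝ) ^ (1 / 4 : ℝ) * lam ^ (5 / 4 : ℝ)) ∧
    (∀ a : ℝ, 0 < a → ∃ c : ℝ, ∀ (n : ℕ) (lam : ℝ), 1 ≤ n →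
      a * (n : ℝ) ^ (-(1 / 5) : ℝ) ≤ lam →
      ∫ ω, SmoothingSpline.roughness n
        (SmoothingSpline.splineFit n lam (SmoothingSpline.observations f σ Z n ω)) ∂P ≤
        c * (n : ℝ) ^ (1 / 4 : ℝ) * lam ^ (5 / 4 : ℝ)) ∧
    -- (c)
    (∃ A : ℝ, 0 < A ∧
      ∀ (lam : ℕ → ℝ) (q : ℝ) (𝓘 : ℕ → Finset (Set ℝ)) (τ : ℝ),
        (∀ᶠ n : ℕ in atTop, A / Real.log n < lam n) →
        (∀ n, ∀ I ∈ 𝓘 n, I.OrdConnected) →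
        (∀ᶠ n : ℕ in atTop, ((𝓘 n).card : ℝ) ≤ q * n) →
        2 < τ →
        Tendsto (fun n : ℕ => P {ω | ∀ I ∈ 𝓘 n,
          |SmoothingSpline.residualSum n (SmoothingSpline.observations f σ Z n ω) I
            (SmoothingSpline.splineFit n (lam n) (SmoothingSpline.observations f σ Z n ω))| ≤
            σ * √(τ * Real.log n)}) atTop (𝓝 1)) := by
  refine ⟨fun n y lam hl => ⟨SmoothingSpline.exists_isSmoothingSpline n y hl,
    fun g g2 hg => hg.eq_splineFit hl⟩, fun n y =>
    ⟨SmoothingSpline.monotoneOn_roughness_splineFit n y,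
      SmoothingSpline.strictMonoOn_roughness_splineFit⟩,
    fun n lam _ => hZ.integrable_roughness n lam f σ,
    ⟨5 * σ ^ 2, fun n lam hl => hZ.integral_roughness_le hf σ n hl⟩,
    fun a ha => ⟨_, fun n lam hn hl => hZ.integral_roughness_le_of_le hf σ ha hn hl⟩,
    1, one_pos, fun lam q 𝓘 τ hlam _ hq hτ =>
      hZ.tendsto_measure_residualSum_le hf hσ hlam hq hτ⟩
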